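/- Let $\mathcal M$ be a matroid on $[n]$, let $x_1,\dots,x_n\in\mathbb R^d$, and for $T\subseteq[n]$ let $\mathrm{vol}(T)=\sqrt{\det(\langle x_i,x_j\rangle)_{i,j\in T}}$. Let $S$ be a basis of $\mathcal M$ with $\mathrm{vol}(S)>0$. For $u\notin S$ write $x_u=\sum_{v\in S}a_{u,v}x_v+u^\perp$ with $u^\perp$ orthogonal to $\mathrm{span}(x_v:v\in S)$; for $v\in S$ let $v^\perp$ be the component of $x_v$ orthogonal to $\mathrm{span}(x_w:w\in S\setminus\{v\})$. The exchange graph $G(S)$ is the directed bipartite graph with sides $[n]\setminus S$ and $S$, with all arcs $u\to v$ ($u\notin S$, $v\in S$), of weight $w_0(u,v)=-\log|a_{u,v}|$, and an arc $v\to u$, of weight $0$, whenever $S-v+u$ is independent in $\mathcal M$. The augmented exchange graph $\widetilde G(S)$ has, for each $u\notin S$, two vertices $u^\parallel$ (parallel) and $u^\perp$ (perpendicular) on the left, and $S$ on the right; it has all arcs $u^\parallel\to v$, of weight $\widetilde w_0=-\log|a_{u,v}|$, all arcs $u^\perp\to v$, of weight $\widetilde w_0=-\log(\|u^\perp\|/\|v^\perp\|)$,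 and arcs $v\to u^\parallel$ and $v\to u^\perp$, of weight $0$, whenever $S-v+u$ is independent in $\mathcal M$ (here $-\log 0=+\infty$). Cycles are directed with distinct vertices, $|C|$ is the number of arcs of $C$, and the weight of a cycle is the sum of the weights of its arcs. Let $f(i)=2(i!)^3$, $\tilde f(1)=2$ and $\tilde f(i)=(i!)^{11}$ for $i\ge2$. A cycle $C$ of $G(S)$ is $f$-violating if $w_0(C)<-\log f(|C|/2)$; a cycle $C$ of $\widetilde G(S)$ is $\tilde f$-violating if $\widetilde w_0(C)<-\log\tilde f(|C|/2)$. For a cycle $C$ of $\widetilde G(S)$ let $\widetilde C\subseteq[n]$ consist of the $u\notin S$ with $u^\perp\in C$ or $u^\parallel\in C$ and the $v\in S$ with $v\in C$. The cycle $C$ is a minimal $\tilde f$-violating cycle if it is $\tilde f$-violating and no cycle $C'$ of $\widetilde G(S)$ with $\widetilde{C'}\subsetneq\widetilde C$ is $\tilde f$-violating. Suppose that $G(S)$ has no $f$-violating cycle, and let $C$ be a minimal $\tilde f$-violating cycle in $\widetilde G(S)$. Then: 1. $C$ contains exactly one perpendicular vertex. 2. If $|C|=2\ell\ge4$, let $u_1,\dots,u_\ell$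 be the elements of $[n]\setminus S$ underlying the left vertices of $C$ and $v_1,\dots,v_\ell$ the elements of $S$ on $C$; then the matrix $W_C=\bigl(|a_{u_i,v_j}|+\|u_i^\perp\|/\|v_j^\perp\|\bigr)_{i,j=1}^{\ell}$ satisfies $\mathrm{per}(W_C)\le1.56\,e^{-\widetilde w_0(C)}$. 3. $\mathrm{vol}(S\,\Delta\,\widetilde C)\ge2\,\mathrm{vol}(S)$. -/

import Mathlib

namespace DetMax

/-- Volume of the parallelepiped spanned by the vectors `x i`, `i ∈ S`: the square root of the
Gram determinant. -/
noncomputable def vol {n d : ℕ} (x : Fin n → EuclideanSpace ℝ (Fin d)) (S : Finset (Fin n)) : ℝ :=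
  Real.sqrt (Matrix.gram ℝ (fun i : {i // i ∈ S} => x i)).det

/-- The span of the vectors indexed by `S`. -/
def spanOf {n d : ℕ} (x : Fin n → EuclideanSpace ℝ (Fin d)) (S : Finset (Fin n)) :
    Submodule ℝ (EuclideanSpace ℝ (Fin d)) :=
  Submodule.span ℝ (Set.range fun i : {i // i ∈ S} => x i)

/-- `u^∥`, the orthogonal projection of the vector of `u` to the span of `S`. -/
noncomputable def par {n d : ℕ} (x : Fin n → EuclideanSpace ℝ (Fin d)) (S : Finset (Fin n))
    (u : Fin n) : EuclideanSpace ℝ (Fin d) :=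
  (spanOf x S).starProjection (x u)

/-- `u^⊥ = u - u^∥`, the component of the vector of `u` orthogonal to the span of `S`. -/
noncomputable def perp {n d : ℕ} (x : Fin n → EuclideanSpace ℝ (Fin d)) (S : Finset (Fin n))
    (u : Fin n) : EuclideanSpace ℝ (Fin d) :=
  x u - par x S u

theorem par_mem {n d : ℕ} (x : Fin n → EuclideanSpace ℝ (Fin d)) (S : Finset (Fin n))
    (u : Fin n) :
    par x S u ∈ Submodule.span ℝ (Set.range fun i : {i // i ∈ S} => x i) :=
  Submodule.starProjection_apply_mem (spanOf x S) (x u)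

/-- The coefficient `a_{u,v}` of `v` in the expansion of `u^∥` in the basis `S` of its span. The
vectors of `S` are linearly independent whenever `vol x S > 0`; otherwise the value is irrelevant. -/
noncomputable def coeff {n d : ℕ} (x : Fin n → EuclideanSpace ℝ (Fin d)) (S : Finset (Fin n))
    (u : Fin n) (v : {v // v ∈ S}) : ℝ :=
  open Classical in
  if h : LinearIndependent ℝ (fun i : {i // i ∈ S} => x i) then
    h.repr ⟨par x S u, par_mem x S u⟩ v
  else 0

/-- `‖u^⊥‖ / ‖v^⊥‖`, where `u^⊥` is orthogonal to the span of `S` and `v^⊥` is the component of `v`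
orthogonal to the span of `S - v`. -/
noncomputable def perpRatio {n d : ℕ} (x : Fin n → EuclideanSpace ℝ (Fin d)) (S : Finset (Fin n))
    (u : Fin n) (v : {v // v ∈ S}) : ℝ :=
  ‖perp x S u‖ / ‖perp x (S.erase v) v‖

/-- `-log t` for `t ≥ 0`, with `-log 0 = +∞`. -/
noncomputable def negLog (t : ℝ) : EReal := -ENNReal.log (ENNReal.ofReal t)

/-- A directed cycle `u₀ → v₀ → u₁ → v₁ → ⋯ → u_{ℓ-1} → v_{ℓ-1} → u₀` with `2ℓ` arcs and pairwise
distinct vertices in a bipartite digraph with sides `L` (containing the `uᵢ`) and `R` (containing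
the `vᵢ`). -/
structure BipCycle {L R : Type} (G : Digraph (L ⊕ R)) where
  len : ℕ
  len_pos : 0 < len
  u : Fin len → L
  v : Fin len → R
  u_inj : Function.Injective u
  v_inj : Function.Injective v
  forward : ∀ i, G.Adj (Sum.inl (u i)) (Sum.inr (v i))
  backward : ∀ i, G.Adj (Sum.inr (v i)) (Sum.inl (u (finRotate len i)))

/-- The weight of a cycle: the sum of the weights of its arcs. -/
noncomputable def BipCycle.weight {L R : Type} {G : Digraph (L ⊕ R)} (C : BipCycle G)
    (w : L ⊕ R → L ⊕ R → EReal) : EReal :=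
  ∑ i, (w (Sum.inl (C.u i)) (Sum.inr (C.v i)) +
    w (Sum.inr (C.v i)) (Sum.inl (C.u (finRotate C.len i))))

/-- `C` is `g`-violating for the weights `w`: `w(C) < - log g(|C|/2)`. -/
def BipCycle.Violating {L R : Type} {G : Digraph (L ⊕ R)} (C : BipCycle G)
    (w : L ⊕ R → L ⊕ R → EReal) (g : ℕ → ℕ) : Prop :=
  C.weight w < negLog (g C.len)

/-! ### The exchange graph -/

/-- Vertices of the exchange graph: the elements outside `S` and the elements of `S`. -/
abbrev Vertex {n : ℕ} (S : Finset (Fin n)) : Type := {u // u ∉ S} ⊕ {v // v ∈ S}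

/-- The exchange graph `G(S)`: all arcs `u → v`, and an arc `v → u` iff `S - v + u` is independent. -/
def exchangeGraph {n : ℕ} (M : Matroid (Fin n)) (S : Finset (Fin n)) : Digraph (Vertex S) where
  Adj
    | Sum.inl _, Sum.inr _ => True
    | Sum.inr v, Sum.inl u => M.Indep (insert u.1 ((S : Set (Fin n)) \ {v.1}))
    | _, _ => False

/-- The arc weights `w₀` of the exchange graph. -/
noncomputable def weight₀ {n d : ℕ} (x : Fin n → EuclideanSpace ℝ (Fin d)) (S : Finset (Fin n)) :
    Vertex S → Vertex S → EReal
  | Sum.inl u, Sum.inr v => negLog |coeff x S u v|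
  | _, _ => 0

/-! ### The augmented exchange graph -/

/-- The two kinds of vertices created for each element outside `S`. -/
inductive Part : Type
  | parallel
  | perpendicular

/-- Vertices of the augmented exchange graph: `u^∥` and `u^⊥` for each `u ∉ S`, and the elements
of `S`. -/
abbrev AugVertex {n : ℕ} (S : Finset (Fin n)) : Type := ({u // u ∉ S} × Part) ⊕ {v // v ∈ S}

/-- The augmented exchange graph: all arcs `u^∥ → v` and `u^⊥ → v`, and arcs `v → u^∥`, `v → u^⊥`
iff `S - v + u` is independent. -/
def augGraph {n : ℕ} (M : Matroid (Fin n)) (S : Finset (Fin n)) : Digraph (AugVertex S) where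
  Adj
    | Sum.inl _, Sum.inr _ => True
    | Sum.inr v, Sum.inl u => M.Indep (insert u.1.1 ((S : Set (Fin n)) \ {v.1}))
    | _, _ => False

/-- The arc weights of the augmented exchange graph. -/
noncomputable def augWeight₀ {n d : ℕ} (x : Fin n → EuclideanSpace ℝ (Fin d))
    (S : Finset (Fin n)) : AugVertex S → AugVertex S → EReal
  | Sum.inl (u, Part.parallel), Sum.inr v => negLog |coeff x S u v|
  | Sum.inl (u, Part.perpendicular), Sum.inr v => negLog (perpRatio x S u v)
  | _, _ => 0

/-- `f(i) = 2 (i!)³`. -/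
def f (i : ℕ) : ℕ := 2 * i.factorial ^ 3

/-- `f̃(1) = 2` and `f̃(i) = (i!)¹¹` for `i ≥ 2`. -/
def fTilde (i : ℕ) : ℕ := if i = 1 then 2 else i.factorial ^ 11

/-- The set of elements of the ground set that occur in a cycle of the augmented exchange graph:
the `u ∉ S` with `u^∥` or `u^⊥` on the cycle, and the `v ∈ S` on the cycle. -/
def support {n : ℕ} {M : Matroid (Fin n)} {S : Finset (Fin n)} (C : BipCycle (augGraph M S)) :
    Finset (Fin n) :=
  Finset.univ.image (fun i => (C.u i).1.1) ∪ Finset.univ.image (fun i => (C.v i).1)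

/-- A minimal `f̃`-violating cycle: an `f̃`-violating cycle such that no cycle on a strictly smaller
set of elements is `f̃`-violating. -/
def MinimalViolating {n d : ℕ} {M : Matroid (Fin n)} (x : Fin n → EuclideanSpace ℝ (Fin d))
    {S : Finset (Fin n)} (C : BipCycle (augGraph M S)) : Prop :=
  C.Violating (augWeight₀ x S) fTilde ∧
    ∀ C' : BipCycle (augGraph M S), support C' ⊂ support C →
      ¬ C'.Violating (augWeight₀ x S) fTilde

/-- The matrix `W_C` with entries `|a_{u,v}| + ‖u^⊥‖ / ‖v^⊥‖`, where `u` and `v` run over the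
elements of the cycle outside `S` and in `S`. -/
noncomputable def cycleMatrix {n d : ℕ} {M : Matroid (Fin n)}
    (x : Fin n → EuclideanSpace ℝ (Fin d)) {S : Finset (Fin n)} (C : BipCycle (augGraph M S)) :
    Matrix (Fin C.len) (Fin C.len) ℝ :=
  Matrix.of fun i j => |coeff x S (C.u i).1 (C.v j)| + perpRatio x S (C.u i).1 (C.v j)

end DetMax

namespace DetMax

open Finset

/-! ### Permanents of nonnegative matrices -/

theorem prod_add_sum_mul_prod_erase_le {ι : Type*} [DecidableEq ι] (s : Finset ι) (x y : ι → ℝ)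
    (hx : ∀ i, 0 ≤ x i) (hy : ∀ i, 0 ≤ y i) :
    ∏ i ∈ s, x i + ∑ i ∈ s, y i * ∏ j ∈ s.erase i, x j ≤ ∏ i ∈ s, (x i + y i) := by
  induction s using Finset.induction_on with
  | empty => simp
  | insert a s ha ih =>
    rw [prod_insert ha, prod_insert ha, sum_insert ha, erase_insert ha]
    have h1 : ∑ i ∈ s, y i * ∏ j ∈ (insert a s).erase i, x j
        = x a * ∑ i ∈ s, y i * ∏ j ∈ s.erase i, x j := by
      rw [mul_sum]
      refine sum_congr rfl fun i hi => ?_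
      have hai : a ≠ i := fun h => ha (h ▸ hi)
      rw [erase_insert_of_ne hai, prod_insert (by simp [ha])]
      ring
    have h2 : ∏ i ∈ s, x i ≤ ∏ i ∈ s, (x i + y i) :=
      prod_le_prod (fun i _ => hx i) fun i _ => by linarith [hy i]
    rw [h1]
    nlinarith [mul_le_mul_of_nonneg_left ih (hx a), mul_le_mul_of_nonneg_left h2 (hy a)]

theorem permanent_eq_sum_prod {n : Type*} [Fintype n] [DecidableEq n] (M : Matrix n n ℝ) :
    M.permanent = ∑ σ : Equiv.Perm n, ∏ i, M i (σ i) := by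
  rw [← Matrix.permanent_transpose]; rfl

theorem permanent_mono {n : Type*} [Fintype n] [DecidableEq n] {M N : Matrix n n ℝ}
    (h0 : ∀ i j, 0 ≤ M i j) (h : ∀ i j, M i j ≤ N i j) : M.permanent ≤ N.permanent :=
  sum_le_sum fun _ _ => prod_le_prod (fun _ _ => h0 _ _) fun _ _ => h _ _

/-- Scaling rows and columns. -/
theorem permanent_scale {n : Type*} [Fintype n] [DecidableEq n] (M : Matrix n n ℝ) (r c : n → ℝ) :
    (Matrix.of fun i j => r i * M i j * c j).permanent
      = (∏ i, r i) * M.permanent * ∏ j, c j := by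
  rw [permanent_eq_sum_prod, permanent_eq_sum_prod, mul_sum, sum_mul]
  refine sum_congr rfl fun σ _ => ?_
  simp only [Matrix.of_apply, prod_mul_distrib]
  rw [Equiv.prod_comp σ c]

/-- Expansion of the permanent along the first row and the first column. -/
theorem permanent_succ {n : ℕ} (M : Matrix (Fin (n + 1)) (Fin (n + 1)) ℝ) :
    M.permanent = ∑ σ : Equiv.Perm (Fin n), (M 0 0 * ∏ i, M i.succ (σ i).succ +
      ∑ i, M i.succ 0 * M 0 (σ i).succ * ∏ j ∈ univ.erase i, M j.succ (σ j).succ) := by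
  rw [permanent_eq_sum_prod, ← Equiv.sum_comp Equiv.Perm.decomposeFin.symm, Fintype.sum_prod_type,
    sum_comm]
  refine sum_congr rfl fun σ _ => ?_
  rw [Fin.sum_univ_succ]
  congr 1
  · rw [Fin.prod_univ_succ]
    simp
  · rw [← Equiv.sum_comp σ]
    refine sum_congr rfl fun i _ => ?_
    rw [Fin.prod_univ_succ, Equiv.Perm.decomposeFin_symm_apply_zero, 
      ← mul_prod_erase univ (fun k : Fin n => M k.succ
        (Equiv.Perm.decomposeFin.symm ((σ i).succ, σ) k.succ)) (mem_univ i),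
      Equiv.Perm.decomposeFin_symm_apply_succ, Equiv.swap_apply_right]
    have h : ∏ j ∈ univ.erase i, M j.succ
        (Equiv.Perm.decomposeFin.symm ((σ i).succ, σ) j.succ) =
        ∏ j ∈ univ.erase i, M j.succ (σ j).succ := by
      refine prod_congr rfl fun j hj => ?_
      rw [Equiv.Perm.decomposeFin_symm_apply_succ,
        Equiv.swap_apply_of_ne_of_ne (Fin.succ_ne_zero _)]
      simpa using (mem_erase.mp hj).1
    rw [h]
    ring

theorem permanent_succ_le {n : ℕ} (M : Matrix (Fin (n + 1)) (Fin (n + 1)) ℝ)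
    (h0 : ∀ i j, 0 ≤ M i j) (h1 : 1 ≤ M 0 0) :
    M.permanent ≤ M 0 0 *
      (Matrix.of fun i j : Fin n => M i.succ j.succ + M i.succ 0 * M 0 j.succ).permanent := by
  rw [permanent_succ, permanent_eq_sum_prod, mul_sum]
  refine sum_le_sum fun σ _ => ?_
  have h := prod_add_sum_mul_prod_erase_le univ (fun i => M i.succ (σ i).succ)
    (fun i => M i.succ 0 * M 0 (σ i).succ) (fun i => h0 _ _)
    (fun i => mul_nonneg (h0 _ _) (h0 _ _))
  simp only [Matrix.of_apply]
  have h2 : 0 ≤ ∑ i, M i.succ 0 * M 0 (σ i).succ * ∏ j ∈ univ.erase i, M j.succ (σ j).succ :=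
    sum_nonneg fun i _ => mul_nonneg (mul_nonneg (h0 _ _) (h0 _ _)) (prod_nonneg fun j _ => h0 _ _)
  nlinarith [mul_le_mul_of_nonneg_left h (zero_le_one.trans h1)]

/-- A nonnegative matrix that differs from a unitriangular one by little has small permanent. -/
theorem permanent_one_add_le {c : ℝ} (n : ℕ) : ∀ (U Λ : Matrix (Fin n) (Fin n) ℝ) (μ : ℝ),
    (∀ i j, 0 ≤ U i j) → (∀ i j, 0 ≤ Λ i j) → (∀ i j, j ≤ i → U i j = 0) →
    (∀ i, ∑ j, U i j ≤ c) → ∑ i, ∑ j, Λ i j ≤ μ → c + μ ≤ 1 → μ < 1 →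
    (1 + U + Λ).permanent ≤ 1 / (1 - μ) := by
  induction n with
  | zero =>
    intro U Λ μ _ _ _ _ hμ _ hμ1
    rw [Matrix.permanent_isEmpty, le_div_iff₀ (by linarith)]
    simp at hμ
    linarith
  | succ n ih =>
    intro U Λ μ hU hΛ hT hr hμ hc hμ1
    set a := Λ 0 0
    have ha : 0 ≤ a := hΛ 0 0
    have hnn : ∀ i j, 0 ≤ (1 + U + Λ) i j := fun i j => by
      simp only [Matrix.add_apply]
      have : (0 : ℝ) ≤ (1 : Matrix (Fin (n+1)) (Fin (n+1)) ℝ) i j := by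
        rw [Matrix.one_apply]; split_ifs <;> norm_num
      linarith [hU i j, hΛ i j]
    have h00 : (1 + U + Λ) 0 0 = 1 + a := by
      simp [hT 0 0 le_rfl, a]
    rw [Fin.sum_univ_succ] at hμ
    simp only [Fin.sum_univ_succ (n := n)] at hμ
    rw [sum_add_distrib] at hμ
    set Λ' : Matrix (Fin n) (Fin n) ℝ :=
      Matrix.of fun i j => Λ i.succ j.succ + Λ i.succ 0 * (U 0 j.succ + Λ 0 j.succ) with hΛ'
    set U' : Matrix (Fin n) (Fin n) ℝ := Matrix.of fun i j => U i.succ j.succ with hU'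
    have hsumnn : 0 ≤ ∑ i : Fin n, ∑ j : Fin n, Λ i.succ j.succ :=
      sum_nonneg fun i _ => sum_nonneg fun j _ => hΛ _ _
    have hcol : 0 ≤ ∑ i : Fin n, Λ i.succ 0 := sum_nonneg fun i _ => hΛ _ _
    have hrow0 : 0 ≤ ∑ j : Fin n, Λ 0 j.succ := sum_nonneg fun i _ => hΛ _ _
    have hUrow : ∑ j : Fin n, U 0 j.succ ≤ c := by
      have := hr 0
      rw [Fin.sum_univ_succ] at this
      linarith [hU 0 0]
    have hmass : ∑ i, ∑ j, Λ' i j ≤ μ - a := by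
      have : ∑ i, ∑ j, Λ' i j = ∑ i : Fin n, ∑ j : Fin n, Λ i.succ j.succ +
          (∑ i : Fin n, Λ i.succ 0) * (∑ j : Fin n, U 0 j.succ + ∑ j : Fin n, Λ 0 j.succ) := by
        simp only [hΛ', Matrix.of_apply, sum_add_distrib, ← mul_sum, sum_mul]
      rw [this]
      have : (∑ i : Fin n, Λ i.succ 0) * (∑ j : Fin n, U 0 j.succ + ∑ j : Fin n, Λ 0 j.succ)
          ≤ (∑ i : Fin n, Λ i.succ 0) * 1 := by
        apply mul_le_mul_of_nonneg_left _ hcol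
        linarith
      linarith
    have key := ih U' Λ' (μ - a) (fun i j => hU _ _)
      (fun i j => add_nonneg (hΛ _ _) (mul_nonneg (hΛ _ _) (add_nonneg (hU _ _) (hΛ _ _))))
      (fun i j hij => hT _ _ (Fin.succ_le_succ_iff.mpr hij))
      (fun i => by
        have := hr i.succ
        rw [Fin.sum_univ_succ] at this
        simp only [hU', Matrix.of_apply]
        linarith [hU i.succ 0]) hmass (by linarith) (by linarith)
    have hM := permanent_succ_le (1 + U + Λ) hnn (by rw [h00]; linarith)
    have heq : (Matrix.of fun i j : Fin n => (1 + U + Λ) i.succ j.succ +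
        (1 + U + Λ) i.succ 0 * (1 + U + Λ) 0 j.succ) = 1 + U' + Λ' := by
      ext i j
      simp [hU', hΛ', Matrix.one_apply, hT i.succ 0 (Fin.zero_le _), Fin.succ_ne_zero,
        (Fin.succ_ne_zero _).symm]
      ring
    rw [heq, h00] at hM
    refine hM.trans ((mul_le_mul_of_nonneg_left key (by linarith)).trans ?_)
    rw [mul_one_div, div_le_div_iff₀ (by linarith) (by linarith)]
    nlinarith

end DetMax

namespace DetMax

open Finset

/-! ### Factorial estimates -/

theorem factorial_mul_le_sq (p q r : ℕ) (hq : 1 ≤ q) :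
    (r + 1) * ((p + q).factorial ^ 2 * ((p + r).factorial * (q + r).factorial)) ≤
      (p + q + r).factorial ^ 2 * (p.factorial * q.factorial) := by
  induction r with
  | zero => simp
  | succ r ih =>
    have key : (r + 2) * ((p + r + 1) * (q + r + 1)) ≤ (r + 1) * (p + q + r + 1) ^ 2 := by
      obtain ⟨q, rfl⟩ := Nat.exists_eq_add_of_le hq
      nlinarith [mul_nonneg (Nat.zero_le p) (Nat.zero_le r), sq_nonneg (p : ℤ), Nat.zero_le (p*q*r),
        Nat.zero_le (p^2*r), Nat.zero_le (q^2*r), Nat.zero_le (p*r^2), Nat.zero_le (q*r^2),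
        Nat.zero_le (q*r), Nat.zero_le (q^2), Nat.zero_le (p^2), Nat.zero_le (p*q)]
    rw [← Nat.add_assoc, ← Nat.add_assoc, ← Nat.add_assoc, Nat.factorial_succ, Nat.factorial_succ,
      Nat.factorial_succ]
    have := Nat.mul_le_mul key ih
    apply Nat.le_of_mul_le_mul_left (c := r + 1) _ (Nat.succ_pos r)
    nlinarith

theorem factorial_mul_le (p q r : ℕ) :
    (p + q).factorial * (p + r).factorial ≤ (p + q + r).factorial * p.factorial := by
  induction r with
  | zero => simp
  | succ r ih =>
    rw [← Nat.add_assoc, ← Nat.add_assoc, Nat.factorial_succ, Nat.factorial_succ]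
    have := Nat.mul_le_mul (show p + r + 1 ≤ p + q + r + 1 by omega) ih
    nlinarith

/-- The reciprocal of a binomial coefficient. -/
noncomputable def invChoose (l i : ℕ) : ℝ := (i.factorial * (l - i).factorial : ℝ) / l.factorial

theorem invChoose_nonneg (l i : ℕ) : 0 ≤ invChoose l i := by unfold invChoose; positivity

theorem invChoose_zero (l : ℕ) : invChoose l 0 = 1 := by
  unfold invChoose
  have : (l.factorial : ℝ) ≠ 0 := by positivity
  simp [this]

theorem invChoose_le {l i : ℕ} (h1 : 1 ≤ i) (h2 : i < l) : invChoose l i ≤ 1 / l := by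
  unfold invChoose
  rw [div_le_div_iff₀ (by positivity) (by exact_mod_cast (by omega : 0 < l)), one_mul]
  obtain ⟨k, rfl⟩ : ∃ k, l = k + 1 := ⟨l - 1, by omega⟩
  rw [Nat.factorial_succ]
  have h : i.factorial * (k + 1 - i).factorial ≤ k.factorial := by
    have := factorial_mul_le 1 (i - 1) (k - i)
    simp only [Nat.factorial_one, mul_one] at this
    rwa [show 1 + (i - 1) = i by omega, show 1 + (k - i) = k + 1 - i by omega,
      show i + (k - i) = k by omega] at this
  have : ((i.factorial * (k + 1 - i).factorial * (k + 1) : ℕ) : ℝ)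
      ≤ (((k + 1) * k.factorial : ℕ) : ℝ) := by
    rw [mul_comm (k + 1)]; exact_mod_cast Nat.mul_le_mul_right _ h
  push_cast at this ⊢
  exact this

theorem sum_invChoose_pow_le {l e : ℕ} (hl : 2 ≤ l) (he : 2 ≤ e) :
    ∑ i : Fin l, invChoose l i ^ e ≤ 1 + (1 / 2) ^ e := by
  obtain ⟨k, rfl⟩ : ∃ k, l = k + 1 := ⟨l - 1, by omega⟩
  obtain ⟨e, rfl⟩ : ∃ e', e = e' + 2 := ⟨e - 2, by omega⟩
  rw [Fin.sum_univ_succ]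
  have h : ∀ i : Fin k, invChoose (k + 1) (i.succ : Fin (k + 1)) ^ (e + 2)
      ≤ (1 / 2) ^ e * (1 / ((k : ℝ) + 1)) ^ 2 := fun i => by
    have h1 := invChoose_le (l := k + 1) (i := (i.succ : Fin (k + 1))) (by simp) (by simp)
    have h0 := invChoose_nonneg (k + 1) (i.succ : Fin (k + 1))
    push_cast at h1
    rw [pow_add]
    have hk : (1 : ℝ) / (k + 1) ≤ 1 / 2 := by
      apply one_div_le_one_div_of_le (by norm_num)
      have : (2 : ℝ) ≤ ((k + 1 : ℕ) : ℝ) := by exact_mod_cast hl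
      push_cast at this
      exact this
    gcongr
    exact h1.trans hk
  have h2 := sum_le_sum fun (i : Fin k) (_ : i ∈ univ) => h i
  simp only [sum_const, card_univ, Fintype.card_fin, nsmul_eq_mul] at h2
  have h3 : (k : ℝ) * (1 / ((k : ℝ) + 1)) ^ 2 ≤ (1 / 2) ^ 2 := by
    rw [div_pow, div_pow, one_pow, mul_one_div, div_le_div_iff₀ (by positivity) (by norm_num)]
    nlinarith [sq_nonneg ((k : ℝ) - 1)]
  rw [Fin.val_zero, invChoose_zero, one_pow]
  gcongr
  calc _ ≤ _ := h2
    _ = (1 / 2) ^ e * ((k : ℝ) * (1 / ((k : ℝ) + 1)) ^ 2) := by ring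
    _ ≤ (1 / 2) ^ e * (1 / 2) ^ 2 := by gcongr
    _ = _ := by rw [pow_add]

/-- The factors by which rows and columns are scaled. -/
noncomputable def scaleFactor (l i : ℕ) : ℝ :=
  (i.factorial : ℝ) ^ 6 * ((l.factorial : ℝ) / (l - i).factorial) ^ 5

theorem scaleFactor_pos (l i : ℕ) : 0 < scaleFactor l i := by unfold scaleFactor; positivity

theorem scale_perp (l i j : ℕ) :
    ((i.factorial * (l - j).factorial : ℝ) / l.factorial) ^ 11 *
      (scaleFactor l j / scaleFactor l i) = invChoose l i ^ 5 * invChoose l j ^ 6 := by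
  unfold scaleFactor invChoose
  have h1 : (i.factorial : ℝ) ≠ 0 := by positivity
  have h2 : (l.factorial : ℝ) ≠ 0 := by positivity
  have h3 : ((l - i).factorial : ℝ) ≠ 0 := by positivity
  have h4 : ((l - j).factorial : ℝ) ≠ 0 := by positivity
  field_simp

theorem scale_upper {l i j : ℕ} (hij : i < j) (hj : j < l) :
    (((l + i - j).factorial : ℝ) / l.factorial) ^ 11 * (scaleFactor l j / scaleFactor l i) ≤
      1 / ((j - i : ℕ) + 1 : ℝ) ^ 5 := by
  obtain ⟨r, rfl⟩ : ∃ r, j = i + r := ⟨j - i, by omega⟩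
  obtain ⟨q, rfl⟩ : ∃ q, l = i + q + r := ⟨l - (i + r), by omega⟩
  have hX := factorial_mul_le i q r
  have hXY := factorial_mul_le_sq i q r (by omega)
  unfold scaleFactor
  rw [show i + q + r + i - (i + r) = i + q by omega, show i + r - i = r by omega,
    show i + q + r - (i + r) = q by omega, show i + q + r - i = q + r by omega]
  have h1 : (i.factorial : ℝ) ≠ 0 := by positivity
  have h2 : ((i + q + r).factorial : ℝ) ≠ 0 := by positivity
  have h3 : (q.factorial : ℝ) ≠ 0 := by positivity
  have h4 : ((q + r).factorial : ℝ) ≠ 0 := by positivity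
  set X : ℝ := (i + q).factorial * (i + r).factorial / ((i + q + r).factorial * i.factorial)
  set Y : ℝ := (i + q).factorial * (q + r).factorial / ((i + q + r).factorial * q.factorial)
  have hXle : X ≤ 1 := by
    rw [div_le_one (by positivity)]
    exact_mod_cast hX
  have hXY' : X * Y ≤ 1 / (r + 1 : ℝ) := by
    simp only [X, Y]
    rw [div_mul_div_comm, div_le_div_iff₀ (by positivity) (by positivity)]
    have : (((r + 1) * ((i + q).factorial ^ 2 * ((i + r).factorial * (q + r).factorial)) : ℕ) : ℝ)
      ≤ (((i + q + r).factorial ^ 2 * (i.factorial * q.factorial) : ℕ) : ℝ) := by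
      exact_mod_cast hXY
    push_cast at this
    linarith
  have hX0 : 0 ≤ X := by positivity
  have hY0 : 0 ≤ Y := by positivity
  calc _ = X * (X * Y) ^ 5 := by simp only [X, Y]; field_simp
    _ ≤ 1 * (1 / (r + 1 : ℝ)) ^ 5 := by gcongr
    _ = _ := by rw [one_mul, div_pow, one_pow]

theorem scale_lower {l i j : ℕ} (hij : j < i) (hi : i < l) :
    ((i - j).factorial : ℝ) ^ 3 * (scaleFactor l j / scaleFactor l i) ≤ 1 / (l : ℝ) ^ 4 := by
  unfold scaleFactor
  obtain ⟨m, rfl⟩ : ∃ m, i = j + m := ⟨i - j, by omega⟩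
  obtain ⟨q, rfl⟩ : ∃ q, l = j + m + q := ⟨l - (j + m), by omega⟩
  rw [show j + m - j = m by omega, show j + m + q - (j + m) = q by omega,
    show j + m + q - j = m + q by omega]
  have h1 : (j.factorial : ℝ) ≠ 0 := by positivity
  have h2 : ((j + m).factorial : ℝ) ≠ 0 := by positivity
  have h3 : (q.factorial : ℝ) ≠ 0 := by positivity
  have h4 : ((m + q).factorial : ℝ) ≠ 0 := by positivity
  have h5 : ((j + m + q).factorial : ℝ) ≠ 0 := by positivity
  set a : ℝ := j.factorial / (j + m).factorial
  set b : ℝ := q.factorial / (m + q).factorial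
  have ha0 : 0 ≤ a := by positivity
  have hb0 : 0 ≤ b := by positivity
  have ha : m.factorial * a ≤ 1 := by
    simp only [a]
    rw [← mul_div_assoc, div_le_one (by positivity), mul_comm]
    exact_mod_cast Nat.le_of_dvd (Nat.factorial_pos _) (Nat.factorial_mul_factorial_dvd_factorial_add j m)
  have hb : m.factorial * b ≤ 1 := by
    simp only [b]
    rw [← mul_div_assoc, div_le_one (by positivity)]
    exact_mod_cast Nat.le_of_dvd (Nat.factorial_pos _) (Nat.factorial_mul_factorial_dvd_factorial_add m q)
  have ha' : a ≤ 1 / (j + m : ℕ) := by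
    simp only [a]
    rw [div_le_div_iff₀ (by positivity) (by exact_mod_cast (by omega : 0 < j + m)), one_mul]
    have : j.factorial * (j + m) ≤ (j + m).factorial := by
      rw [← Nat.mul_factorial_pred (by omega : j + m ≠ 0), mul_comm]
      exact Nat.mul_le_mul_left _ (Nat.factorial_le (by omega))
    exact_mod_cast this
  have hb' : b ≤ 1 / (m + q : ℕ) := by
    simp only [b]
    rw [div_le_div_iff₀ (by positivity) (by exact_mod_cast (by omega : 0 < m + q)), one_mul]
    have : q.factorial * (m + q) ≤ (m + q).factorial := by
      rw [← Nat.mul_factorial_pred (by omega : m + q ≠ 0), mul_comm]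
      exact Nat.mul_le_mul_left _ (Nat.factorial_le (by omega))
    exact_mod_cast this
  have hab : a * b ≤ 1 / ((j + m + q : ℕ) : ℝ) := by
    calc a * b ≤ 1 / (j + m : ℕ) * (1 / (m + q : ℕ)) := by gcongr
      _ = 1 / (((j + m) * (m + q) : ℕ) : ℝ) := by push_cast; rw [one_div_mul_one_div]
      _ ≤ _ := by
        apply one_div_le_one_div_of_le (by exact_mod_cast (by omega : 0 < j + m + q))
        have h6 : 1 ≤ m := by omega
        have h7 : 1 ≤ q := by omega
        have : j + m + q ≤ (j + m) * (m + q) := by nlinarith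
        exact_mod_cast this
  calc _ = (m.factorial * a) ^ 2 * (m.factorial * b) * (a * b) ^ 4 := by
        simp only [a, b]; field_simp
    _ ≤ 1 ^ 2 * 1 * (1 / ((j + m + q : ℕ) : ℝ)) ^ 4 := by gcongr
    _ = _ := by rw [div_pow]; simp

theorem f_le_fTilde {m : ℕ} (hm : 1 ≤ m) : f m ≤ fTilde m := by
  unfold f fTilde
  split_ifs with h
  · subst h; simp
  · have h2 : 2 ≤ m.factorial := by
      calc 2 = Nat.factorial 2 := rfl
        _ ≤ _ := Nat.factorial_le (by omega)
    calc 2 * m.factorial ^ 3 ≤ m.factorial * m.factorial ^ 3 := Nat.mul_le_mul_right _ h2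
      _ = m.factorial ^ 4 := by ring
      _ ≤ _ := Nat.pow_le_pow_right (by omega) (by omega)

theorem fTilde_le (m : ℕ) : fTilde m ≤ 2 * m.factorial ^ 11 := by
  unfold fTilde
  split_ifs with h
  · subst h; simp
  · omega

theorem fTilde_of_ne_one {m : ℕ} (hm : m ≠ 1) : fTilde m = m.factorial ^ 11 := if_neg hm

theorem fTilde_mul_le {a b : ℕ} (ha : 1 ≤ a) (hb : 1 ≤ b) :
    fTilde a * fTilde b ≤ fTilde (a + b) := by
  rw [fTilde_of_ne_one (show a + b ≠ 1 by omega)]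
  have h : 2 * (a.factorial * b.factorial) ≤ (a + b).factorial := by
    obtain ⟨c, rfl⟩ : ∃ c, b = c + 1 := ⟨b - 1, by omega⟩
    have h1 := factorial_mul_le 1 (a - 1) c
    simp only [Nat.factorial_one, mul_one] at h1
    rw [show 1 + (a - 1) = a by omega, Nat.add_comm 1 c] at h1
    rw [← Nat.add_assoc, Nat.factorial_succ (a + c)]
    exact Nat.mul_le_mul (by omega) h1
  calc fTilde a * fTilde b ≤ (2 * a.factorial ^ 11) * (2 * b.factorial ^ 11) :=
        Nat.mul_le_mul (fTilde_le a) (fTilde_le b)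
    _ ≤ 2 ^ 11 * (a.factorial ^ 11 * b.factorial ^ 11) := by
        nlinarith [Nat.zero_le (a.factorial ^ 11 * b.factorial ^ 11)]
    _ = (2 * (a.factorial * b.factorial)) ^ 11 := by ring
    _ ≤ _ := Nat.pow_le_pow_left h 11

end DetMax

namespace DetMax

open Finset

theorem sum_upper_le {i : ℕ} : ∀ n : ℕ, i + 1 ≤ n →
    ∑ j ∈ range n, (if i < j then 2 / ((j - i : ℕ) + 1 : ℝ) ^ 5 else 0) ≤
      1 / 4 - 1 / 4 * (1 / (n - i : ℝ)) := by
  intro n hn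
  induction n, hn using Nat.le_induction with
  | base =>
    rw [sum_eq_zero fun j hj => if_neg (by have := mem_range.mp hj; omega)]
    push_cast
    rw [show (i : ℝ) + 1 - i = 1 by ring]
    norm_num
  | succ n hn ih =>
    rw [sum_range_succ, if_pos (by omega)]
    obtain ⟨r, rfl⟩ : ∃ r, n = i + (r + 1) := ⟨n - i - 1, by omega⟩
    rw [show i + (r + 1) - i = r + 1 by omega]
    push_cast at ih ⊢
    rw [show (i : ℝ) + (r + 1) - i = r + 1 by ring] at ih
    rw [show (i : ℝ) + (r + 1) + 1 - i = r + 2 by ring, show (r : ℝ) + 1 + 1 = r + 2 by ring]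
    have hr : (0 : ℝ) ≤ r := by positivity
    have h : 2 / ((r : ℝ) + 2) ^ 5 ≤ 1 / 4 * (1 / (r + 1)) - 1 / 4 * (1 / (r + 2)) := by
      rw [show 1 / 4 * (1 / ((r : ℝ) + 1)) - 1 / 4 * (1 / (r + 2))
        = 1 / (4 * ((r + 1) * (r + 2))) by field_simp; ring, div_le_div_iff₀ (by positivity) (by positivity)]
      have h3 : 8 * ((r : ℝ) + 1) ≤ (r + 2) ^ 4 := by nlinarith [sq_nonneg (r ^ 2 : ℝ), sq_nonneg (r : ℝ), mul_nonneg hr (sq_nonneg (r : ℝ))]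
      nlinarith
    linarith

theorem sum_lower_le {l : ℕ} (hl : 2 ≤ l) :
    ∑ i : Fin l, ∑ j : Fin l, (if j < i then 2 / (l : ℝ) ^ 4 else 0) ≤ 1 / 8 := by
  have h : ∀ i : Fin l, ∑ j : Fin l, (if j < i then 2 / (l : ℝ) ^ 4 else 0)
      = (i : ℕ) * (2 / (l : ℝ) ^ 4) := fun i => by
    rw [← sum_filter, sum_const, nsmul_eq_mul]
    congr 2
    rw [← Fin.card_Iio i]
    congr 1
    ext j
    simp
  simp_rw [h]
  rw [← sum_mul, Fin.sum_univ_eq_sum_range (fun i => (i : ℝ)) l, ← mul_div_assoc]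
  have h2 : (∑ i ∈ range l, (i : ℝ)) * 2 = l * (l - 1) := by
    have := Finset.sum_range_id_mul_two l
    have h3 : (((∑ i ∈ range l, i) * 2 : ℕ) : ℝ) = ((l * (l - 1) : ℕ) : ℝ) := by rw [this]
    push_cast [Nat.cast_sub (show 1 ≤ l by omega)] at h3
    exact h3
  rw [h2, div_le_div_iff₀ (by positivity) (by norm_num)]
  have hl' : (2 : ℝ) ≤ l := by exact_mod_cast hl
  have : 8 * ((l : ℝ) - 1) ≤ l ^ 3 := by nlinarith [sq_nonneg ((l : ℝ) - 2)]
  nlinarith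

theorem permanent_scaled_le {l : ℕ} (hl : 2 ≤ l) (A P : Fin l → Fin l → ℝ)
    (hA0 : ∀ i j, 0 ≤ A i j) (hP0 : ∀ i j, 0 ≤ P i j)
    (hdiag : ∀ i : Fin l, (i : ℕ) ≠ 0 → A i i ≤ 1)
    (h00 : ∀ i : Fin l, (i : ℕ) = 0 → A i i ≤ 1 / 128)
    (hlow : ∀ i j : Fin l, j < i → A i j ≤ 2 * ((i - j : ℕ).factorial : ℝ) ^ 3)
    (hup : ∀ i j : Fin l, i < j →
      A i j ≤ 2 * (((l + i - j : ℕ).factorial : ℝ) / l.factorial) ^ 11)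
    (hP00 : ∀ i : Fin l, (i : ℕ) = 0 → P i i ≤ 1)
    (hP : ∀ i j : Fin l, P i j ≤
      4 * (((i : ℕ).factorial * (l - j : ℕ).factorial : ℝ) / l.factorial) ^ 11) :
    (Matrix.of fun i j => A i j + P i j).permanent ≤ 3 / 2 := by
  have : NeZero l := ⟨by omega⟩
  set t : Fin l → ℝ := fun i => scaleFactor l i with ht
  have htp : ∀ i, 0 < t i := fun i => scaleFactor_pos l i
  have hscale := permanent_scale (Matrix.of fun i j => A i j + P i j) (fun i => (t i)⁻¹) t
  rw [prod_inv_distrib, mul_right_comm,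
    inv_mul_cancel₀ (prod_ne_zero_iff.mpr fun i _ => (htp i).ne'), one_mul] at hscale
  rw [← hscale]
  set U : Matrix (Fin l) (Fin l) ℝ :=
    Matrix.of fun i j => if i < j then 2 / ((j - i : ℕ) + 1 : ℝ) ^ 5 else 0 with hU
  set Q : Fin l → Fin l → ℝ := fun i j => 4 * (invChoose l i ^ 5 * invChoose l j ^ 6)
  set Λ : Matrix (Fin l) (Fin l) ℝ := Matrix.of fun i j =>
    Q i j + (if i = 0 then if j = 0 then (1 / 128 - 4 : ℝ) else 0 else 0) +
      (if j < i then 2 / (l : ℝ) ^ 4 else 0) with hΛ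
  have hQ00 : Q 0 0 = 4 := by simp [Q, invChoose_zero]
  have hQ0 : ∀ i j, 0 ≤ Q i j := fun i j =>
    mul_nonneg (by norm_num) (mul_nonneg (pow_nonneg (invChoose_nonneg _ _) _)
      (pow_nonneg (invChoose_nonneg _ _) _))
  have hU0 : ∀ i j, 0 ≤ U i j := fun i j => by
    simp only [hU, Matrix.of_apply]; split_ifs <;> positivity
  have hc : ∀ i j : Fin l, 0 ≤ (if j < i then 2 / (l : ℝ) ^ 4 else 0) := fun i j => by
    split_ifs <;> positivity
  have hΛ0 : ∀ i j, 0 ≤ Λ i j := fun i j => by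
    simp only [hΛ, Matrix.of_apply]
    refine add_nonneg ?_ (hc i j)
    split_ifs with h1 h2
    · subst h1; subst h2; rw [hQ00]; norm_num
    · simpa using hQ0 i j
    · simpa using hQ0 i j
  have hQs : ∀ i j, P i j * (t j / t i) ≤ Q i j := fun i j => by
    calc _ ≤ _ := mul_le_mul_of_nonneg_right (hP i j) (div_pos (htp j) (htp i)).le
      _ = Q i j := by rw [mul_assoc, scale_perp]
  have hmass : ∑ i, ∑ j, Λ i j ≤ 1 / 3 := by
    have h1 : ∑ i, ∑ j, Q i j = 4 * ((∑ i : Fin l, invChoose l i ^ 5) *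
        ∑ j : Fin l, invChoose l j ^ 6) := by
      simp only [Q, ← mul_sum, sum_mul]
    have h2 : ∑ i : Fin l, ∑ j : Fin l,
        (if i = 0 then if j = 0 then (1 / 128 - 4 : ℝ) else 0 else 0) = 1 / 128 - 4 := by
      rw [sum_eq_single 0]
      · simp
      · intro i _ hi; simp [hi]
      · simp
    simp only [hΛ, Matrix.of_apply, sum_add_distrib]
    rw [h1, h2]
    have h3 := sum_lower_le hl
    have h4 := sum_invChoose_pow_le hl (show 2 ≤ 5 by norm_num)
    have h5 := sum_invChoose_pow_le hl (show 2 ≤ 6 by norm_num)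
    have h6 : (∑ i : Fin l, invChoose l i ^ 5) * ∑ j : Fin l, invChoose l j ^ 6 ≤
        (1 + (1 / 2) ^ 5) * (1 + (1 / 2) ^ 6) :=
      mul_le_mul h4 h5 (sum_nonneg fun i _ => pow_nonneg (invChoose_nonneg _ _) _) (by norm_num)
    norm_num at h6 h3 ⊢
    linarith
  have hrow : ∀ i, ∑ j, U i j ≤ 1 / 4 := fun i => by
    have h := sum_upper_le (i := i) l i.2
    rw [← Fin.sum_univ_eq_sum_range
      (fun j => if (i : ℕ) < j then 2 / ((j - i : ℕ) + 1 : ℝ) ^ 5 else 0) l] at h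
    have hi : (0 : ℝ) < (l : ℝ) - (i : ℕ) := by
      have : ((i : ℕ) : ℝ) < l := by exact_mod_cast i.2
      linarith
    have : 0 ≤ 1 / 4 * (1 / ((l : ℝ) - (i : ℕ))) := by positivity
    simp only [hU, Matrix.of_apply, Fin.lt_def]
    linarith
  have hmain := permanent_one_add_le (c := 1 / 4) l U Λ (1 / 3) hU0 hΛ0
    (fun i j hij => by simp [hU, not_lt.mpr hij]) hrow hmass (by norm_num) (by norm_num)
  refine (permanent_mono (fun i j => ?_) fun i j => ?_).trans (hmain.trans (by norm_num))
  · exact mul_nonneg (mul_nonneg (inv_nonneg.mpr (htp i).le) (add_nonneg (hA0 i j) (hP0 i j)))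
      (htp j).le
  · simp only [Matrix.of_apply, Matrix.add_apply]
    rw [show (t i)⁻¹ * (A i j + P i j) * t j = A i j * (t j / t i) + P i j * (t j / t i) by
      field_simp]
    have hpos := div_pos (htp j) (htp i)
    rcases lt_trichotomy i j with hij | rfl | hij
    · have h1 : A i j * (t j / t i) ≤ U i j := by
        simp only [hU, Matrix.of_apply, if_pos hij]
        calc _ ≤ _ := mul_le_mul_of_nonneg_right (hup i j hij) hpos.le
          _ ≤ 2 * (1 / ((j - i : ℕ) + 1 : ℝ) ^ 5) := by
            rw [mul_assoc]
            exact mul_le_mul_of_nonneg_left (scale_upper hij j.2) (by norm_num)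
          _ = _ := by ring
      have h2 : P i j * (t j / t i) ≤ Λ i j := by
        have h3 : j ≠ 0 := (lt_of_le_of_lt (Fin.zero_le _) hij).ne'
        simp only [hΛ, Matrix.of_apply, if_neg h3, ite_self, add_zero]
        linarith [hQs i j, hc i j]
      rw [Matrix.one_apply_ne hij.ne]
      linarith
    · rw [div_self (htp i).ne', mul_one, mul_one, Matrix.one_apply_eq]
      have h5 : U i i = 0 := by simp [hU]
      by_cases hi : i = 0
      · subst hi
        have h1 := h00 0 rfl
        have h2 := hP00 0 rfl
        have h4 : Λ 0 0 = 1 / 128 := by simp [hΛ, hQ00]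
        rw [h4, h5]
        linarith
      · have h1 := hdiag i (fun h => hi (Fin.ext h))
        have h2 := hQs i i
        rw [div_self (htp i).ne', mul_one] at h2
        have h4 : Λ i i = Q i i := by simp [hΛ, hi]
        rw [h4, h5]
        linarith
    · have h1 : A i j * (t j / t i) ≤ 2 / (l : ℝ) ^ 4 := by
        calc _ ≤ _ := mul_le_mul_of_nonneg_right (hlow i j hij) hpos.le
          _ ≤ 2 * (1 / (l : ℝ) ^ 4) := by
            rw [mul_assoc]
            exact mul_le_mul_of_nonneg_left (scale_lower hij i.2) (by norm_num)
          _ = _ := by ring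
      have h2 : Λ i j = Q i j + 2 / (l : ℝ) ^ 4 := by
        have h3 : i ≠ 0 := (lt_of_le_of_lt (Fin.zero_le _) hij).ne'
        simp [hΛ, h3, hij]
      rw [Matrix.one_apply_ne hij.ne', h2]
      linarith [hQs i j, hU0 i j]

end DetMax

namespace DetMax

open Finset

/-! ### Weights as products -/

theorem negLog_mul (a : ℝ) {b : ℝ} (hb : 0 ≤ b) : negLog (b * a) = negLog b + negLog a := by
  unfold negLog
  rw [ENNReal.ofReal_mul hb, ENNReal.log_mul_add, EReal.neg_add, sub_eq_add_neg]
  · right; simp [-ENNReal.log_ofReal]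
  · left; simp [-ENNReal.log_ofReal]

theorem negLog_prod {ι : Type*} (s : Finset ι) (d : ι → ℝ) (hd : ∀ i, 0 ≤ d i) :
    negLog (∏ i ∈ s, d i) = ∑ i ∈ s, negLog (d i) := by
  classical
  induction s using Finset.induction_on with
  | empty => simp [negLog]
  | insert a s ha ih => rw [prod_insert ha, sum_insert ha, negLog_mul _ (hd a), ih]

theorem negLog_lt_negLog {a b : ℝ} (hb : 0 ≤ b) : negLog a < negLog b ↔ b < a := by
  unfold negLog
  rw [EReal.neg_lt_neg_iff, ENNReal.log_lt_log_iff, ENNReal.ofReal_lt_ofReal_iff_of_nonneg hb]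

theorem exp_neg_negLog (a : ℝ) : EReal.exp (-negLog a) = ENNReal.ofReal a := by
  rw [negLog, neg_neg, ENNReal.exp_log]

variable {n d : ℕ} {M : Matroid (Fin n)} (x : Fin n → EuclideanSpace ℝ (Fin d))
  {S : Finset (Fin n)}

/-- The exponential of minus the weight of the arc from the copy of `u` of kind `p` to `v`. -/
noncomputable def arcValue (p : Part) (u : Fin n) (v : {v // v ∈ S}) : ℝ :=
  match p with
  | Part.parallel => |coeff x S u v|
  | Part.perpendicular => perpRatio x S u v

theorem perpRatio_nonneg (u : Fin n) (v : {v // v ∈ S}) : 0 ≤ perpRatio x S u v := by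
  unfold perpRatio; positivity

theorem arcValue_nonneg (p : Part) (u : Fin n) (v : {v // v ∈ S}) : 0 ≤ arcValue x p u v := by
  cases p
  · exact abs_nonneg _
  · exact perpRatio_nonneg x u v

theorem perpRatio_mul_swap (u u' : Fin n) (v v' : {v // v ∈ S}) :
    perpRatio x S u v * perpRatio x S u' v' = perpRatio x S u v' * perpRatio x S u' v := by
  unfold perpRatio; ring

theorem weight_eq (C : BipCycle (augGraph M S)) :
    C.weight (augWeight₀ x S) = negLog (∏ i, arcValue x (C.u i).2 (C.u i).1 (C.v i)) := by
  rw [negLog_prod _ _ fun i => arcValue_nonneg x _ _ _]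
  refine sum_congr rfl fun i _ => ?_
  rcases h : C.u i with ⟨u, p⟩
  cases p <;> simp [augWeight₀, arcValue]

theorem violating_iff (C : BipCycle (augGraph M S)) (g : ℕ → ℕ) :
    C.Violating (augWeight₀ x S) g ↔
      (g C.len : ℝ) < ∏ i, arcValue x (C.u i).2 (C.u i).1 (C.v i) := by
  rw [BipCycle.Violating, weight_eq, negLog_lt_negLog (Nat.cast_nonneg _)]

theorem violating_exchange_iff (C : BipCycle (exchangeGraph M S)) (g : ℕ → ℕ) :
    C.Violating (weight₀ x S) g ↔
      (g C.len : ℝ) < ∏ i, arcValue x Part.parallel (C.u i) (C.v i) := by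
  have h : C.weight (weight₀ x S) = negLog (∏ i, arcValue x Part.parallel (C.u i) (C.v i)) := by
    rw [negLog_prod _ _ fun i => arcValue_nonneg x _ _ _]
    exact sum_congr rfl fun i _ => add_zero _
  rw [BipCycle.Violating, h, negLog_lt_negLog (Nat.cast_nonneg _)]

/-! ### Shortcutting a cycle -/

namespace BipCycle

variable (C : BipCycle (augGraph M S))

/-- The left vertices of a cycle as a periodic sequence. -/
def useq (k : ℕ) : {u // u ∉ S} × Part := C.u ⟨k % C.len, Nat.mod_lt _ C.len_pos⟩

/-- The right vertices of a cycle as a periodic sequence. -/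
def vseq (k : ℕ) : {v // v ∈ S} := C.v ⟨k % C.len, Nat.mod_lt _ C.len_pos⟩

theorem useq_add_len (k : ℕ) : C.useq (k + C.len) = C.useq k := by simp [useq]

theorem vseq_add_len (k : ℕ) : C.vseq (k + C.len) = C.vseq k := by simp [vseq]

theorem useq_val (i : Fin C.len) : C.useq i = C.u i := by
  simp [useq, Nat.mod_eq_of_lt i.2]

theorem vseq_val (i : Fin C.len) : C.vseq i = C.v i := by
  simp [vseq, Nat.mod_eq_of_lt i.2]

theorem eq_of_mod_eq {l a b s : ℕ} (h : a % l = b % l) (ha : s ≤ a) (ha' : a < s + l)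
    (hb : s ≤ b) (hb' : b < s + l) : a = b := by
  have h1 : (a - s) ≡ (b - s) [MOD l] := by
    have : (a - s) + s ≡ (b - s) + s [MOD l] := by
      rw [Nat.sub_add_cancel ha, Nat.sub_add_cancel hb]; exact h
    exact Nat.ModEq.add_right_cancel' s this
  have := Nat.ModEq.eq_of_lt_of_lt h1 (by omega) (by omega)
  omega

theorem useq_inj {a b s : ℕ} (h : C.useq a = C.useq b) (ha : s ≤ a) (ha' : a < s + C.len)
    (hb : s ≤ b) (hb' : b < s + C.len) : a = b :=
  eq_of_mod_eq (Fin.ext_iff.mp (C.u_inj h)) ha ha' hb hb'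

theorem vseq_inj {a b s : ℕ} (h : C.vseq a = C.vseq b) (ha : s ≤ a) (ha' : a < s + C.len)
    (hb : s ≤ b) (hb' : b < s + C.len) : a = b :=
  eq_of_mod_eq (Fin.ext_iff.mp (C.v_inj h)) ha ha' hb hb'

theorem indep_seq (k : ℕ) :
    M.Indep (insert (C.useq (k + 1)).1.1 ((S : Set (Fin n)) \ {(C.vseq k).1})) := by
  have h := C.backward ⟨k % C.len, Nat.mod_lt _ C.len_pos⟩
  have h2 : finRotate C.len ⟨k % C.len, Nat.mod_lt _ C.len_pos⟩
      = ⟨(k + 1) % C.len, Nat.mod_lt _ C.len_pos⟩ := by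
    have : NeZero C.len := ⟨C.len_pos.ne'⟩
    rw [finRotate_apply]
    ext
    simp [Fin.val_add]
  rw [h2] at h
  exact h

/-- The cycle obtained by closing the path from `vseq s` to `useq (s + m + 1)`, with the last left
vertex replaced by the copy of kind `p`. -/
def window (s m : ℕ) (hm : m < C.len) (p : Part)
    (hinj : ∀ k < m, C.useq (s + k + 1) ≠ ((C.useq (s + m + 1)).1, p)) :
    BipCycle (augGraph M S) where
  len := m + 1
  len_pos := Nat.succ_pos m
  u i := if (i : ℕ) = m then ((C.useq (s + m + 1)).1, p) else C.useq (s + i + 1)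
  v i := if (i : ℕ) = m then C.vseq s else C.vseq (s + i + 1)
  u_inj i j h := by
    have hi := i.2
    have hj := j.2
    ext
    dsimp only at h
    split_ifs at h with h1 h2 h2
    · omega
    · exact absurd h.symm (hinj j (by omega))
    · exact absurd h (hinj i (by omega))
    · have := C.useq_inj (s := s + 1) h (by omega) (by omega) (by omega) (by omega)
      omega
  v_inj i j h := by
    have hi := i.2
    have hj := j.2
    ext
    dsimp only at h
    split_ifs at h with h1 h2 h2
    · omega
    · have := C.vseq_inj (s := s) h (by omega) (by omega) (by omega) (by omega)
      omega
    · have := C.vseq_inj (s := s) h (by omega) (by omega) (by omega) (by omega)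
      omega
    · have := C.vseq_inj (s := s) h (by omega) (by omega) (by omega) (by omega)
      omega
  forward _ := trivial
  backward i := by
    have hi := i.2
    have hu : ∀ j : Fin (m + 1), (if (j : ℕ) = m then ((C.useq (s + m + 1)).1, p)
        else C.useq (s + j + 1)).1 = (C.useq (s + j + 1)).1 := fun j => by
      split_ifs with h
      · rw [h]
      · rfl
    change M.Indep (insert (Subtype.val (Prod.fst _)) _)
    rw [hu, coe_finRotate]
    by_cases h : (i : ℕ) = m
    · rw [if_pos (Fin.ext h), if_pos h]
      exact C.indep_seq s
    · rw [if_neg (fun h' => h (Fin.ext_iff.mp h')), if_neg h]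
      exact C.indep_seq (s + i + 1)

/-- The cycle of the exchange graph obtained by closing the path from `vseq s` to
`useq (s + m + 1)`. -/
def parallelWindow (s m : ℕ) (hm : m < C.len)
    (hinj : ∀ k ≤ m, ∀ k' ≤ m, (C.useq (s + k + 1)).1 = (C.useq (s + k' + 1)).1 → k = k') :
    BipCycle (exchangeGraph M S) where
  len := m + 1
  len_pos := Nat.succ_pos m
  u i := (C.useq (s + i + 1)).1
  v i := if (i : ℕ) = m then C.vseq s else C.vseq (s + i + 1)
  u_inj i j h := Fin.ext (hinj i (by omega) j (by omega) h)
  v_inj i j h := by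
    have hi := i.2
    have hj := j.2
    ext
    dsimp only at h
    split_ifs at h with h1 h2 h2
    · omega
    · have := C.vseq_inj (s := s) h (by omega) (by omega) (by omega) (by omega)
      omega
    · have := C.vseq_inj (s := s) h (by omega) (by omega) (by omega) (by omega)
      omega
    · have := C.vseq_inj (s := s) h (by omega) (by omega) (by omega) (by omega)
      omega
  forward _ := trivial
  backward i := by
    have hi := i.2
    change M.Indep (insert (Subtype.val (Prod.fst _)) _)
    rw [coe_finRotate]
    by_cases h : (i : ℕ) = m
    · rw [if_pos (Fin.ext h), if_pos h]
      exact C.indep_seq s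
    · rw [if_neg (fun h' => h (Fin.ext_iff.mp h')), if_neg h]
      exact C.indep_seq (s + i + 1)

theorem support_window_ssubset (s m : ℕ) (hm : m + 1 < C.len) (p : Part)
    (hinj : ∀ k < m, C.useq (s + k + 1) ≠ ((C.useq (s + m + 1)).1, p)) :
    support (C.window s m (by omega) p hinj) ⊂ support C := by
  have hu : ∀ k, (C.useq k).1.1 ∈ support C := fun k =>
    mem_union_left _ (mem_image_of_mem _ (mem_univ _))
  have hv : ∀ k, (C.vseq k).1 ∈ support C := fun k =>
    mem_union_right _ (mem_image_of_mem _ (mem_univ _))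
  rw [Finset.ssubset_iff_of_subset]
  · refine ⟨_, hv (s + m + 1), fun h => ?_⟩
    rcases mem_union.mp h with h | h
    · obtain ⟨i, -, hi⟩ := mem_image.mp h
      exact ((C.window s m (by omega) p hinj).u i).1.2 (hi ▸ (C.vseq (s + m + 1)).2)
    · obtain ⟨i, -, hi⟩ := mem_image.mp h
      have hi' := Subtype.ext hi
      have hlt : (i : ℕ) < m + 1 := i.2
      simp only [window] at hi'
      split_ifs at hi' with h1
      · have := C.vseq_inj (s := s) hi' (by omega) (by omega) (by omega) (by omega)
        omega
      · have := C.vseq_inj (s := s) hi' (by omega) (by omega) (by omega) (by omega)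
        omega
  · intro a ha
    rcases mem_union.mp ha with h | h
    · obtain ⟨i, -, rfl⟩ := mem_image.mp h
      simp only [window]
      split_ifs
      · exact hu _
      · exact hu _
    · obtain ⟨i, -, rfl⟩ := mem_image.mp h
      simp only [window]
      split_ifs
      · exact hv _
      · exact hv _

/-- The value of the `k`-th forward arc of a cycle. -/
noncomputable def dseq (k : ℕ) : ℝ := arcValue x (C.useq k).2 (C.useq k).1 (C.vseq k)

theorem dseq_nonneg (k : ℕ) : 0 ≤ C.dseq x k := arcValue_nonneg x _ _ _

theorem dseq_add_len (k : ℕ) : C.dseq x (k + C.len) = C.dseq x k := by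
  simp [dseq, useq_add_len, vseq_add_len]

theorem prod_dseq : ∏ k ∈ range C.len, C.dseq x k
    = ∏ i, arcValue x (C.u i).2 (C.u i).1 (C.v i) := by
  rw [← Fin.prod_univ_eq_prod_range]
  simp [dseq, useq_val, vseq_val]

theorem prod_dseq_shift (s : ℕ) : ∏ k ∈ range C.len, C.dseq x (s + k)
    = ∏ k ∈ range C.len, C.dseq x k := by
  induction s with
  | zero => simp
  | succ s ih =>
    obtain ⟨l, hl⟩ : ∃ l, C.len = l + 1 := ⟨C.len - 1, by have := C.len_pos; omega⟩
    rw [← ih, hl, prod_range_succ, prod_range_succ', ← Nat.add_right_comm, Nat.add_assoc s l 1,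
      ← hl, dseq_add_len, Nat.add_zero]
    congr 1
    exact prod_congr rfl fun k _ => by rw [Nat.add_right_comm, Nat.add_assoc]

theorem window_le (hC : MinimalViolating x C) (s m : ℕ) (hm : m + 1 < C.len) (p : Part)
    (hinj : ∀ k < m, C.useq (s + k + 1) ≠ ((C.useq (s + m + 1)).1, p)) :
    (∏ k ∈ range m, C.dseq x (s + k + 1)) *
      arcValue x p (C.useq (s + m + 1)).1 (C.vseq s) ≤ fTilde (m + 1) := by
  have h := hC.2 _ (C.support_window_ssubset s m hm p hinj)
  rw [violating_iff, not_lt] at h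
  refine le_trans (le_of_eq ?_) h
  change _ = ∏ i : Fin (m + 1), _
  rw [Fin.prod_univ_castSucc, ← Fin.prod_univ_eq_prod_range]
  congr 1
  · refine prod_congr rfl fun i _ => ?_
    simp [window, dseq, i.2.ne]
  · simp [window]

theorem parallelWindow_le (hstage : ∀ D : BipCycle (exchangeGraph M S),
      ¬ D.Violating (weight₀ x S) f) (s m : ℕ) (hm : m < C.len)
    (hinj : ∀ k ≤ m, ∀ k' ≤ m, (C.useq (s + k + 1)).1 = (C.useq (s + k' + 1)).1 → k = k')
    (hpar : ∀ k < m, (C.useq (s + k + 1)).2 = Part.parallel) :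
    (∏ k ∈ range m, C.dseq x (s + k + 1)) *
      arcValue x Part.parallel (C.useq (s + m + 1)).1 (C.vseq s) ≤ f (m + 1) := by
  have h := hstage (C.parallelWindow s m hm hinj)
  rw [violating_exchange_iff, not_lt] at h
  refine le_trans (le_of_eq ?_) h
  change _ = ∏ i : Fin (m + 1), _
  rw [Fin.prod_univ_castSucc, ← Fin.prod_univ_eq_prod_range]
  congr 1
  · refine prod_congr rfl fun i _ => ?_
    simp [parallelWindow, dseq, i.2.ne, hpar i i.2]
  · simp [parallelWindow]

end BipCycle

end DetMax

namespace DetMax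

open Finset

namespace BipCycle

variable {n d : ℕ} {M : Matroid (Fin n)} {x : Fin n → EuclideanSpace ℝ (Fin d)}
  {S : Finset (Fin n)} {C : BipCycle (augGraph M S)}

theorem fTilde_lt_prod_dseq (hC : MinimalViolating x C) (s : ℕ) :
    (fTilde C.len : ℝ) < ∏ k ∈ range C.len, C.dseq x (s + k) := by
  rw [prod_dseq_shift, prod_dseq]
  exact (violating_iff x C fTilde).mp hC.1

/-- A minimal violating cycle cannot be split into two cycles of the same total weight. -/
theorem false_of_swap (hC : MinimalViolating x C) (i a b : ℕ) (hl : C.len = a + b + 2)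
    (p p' : Part) (h1 : ∀ k < a, C.useq (i + k + 1) ≠ ((C.useq (i + a + 1)).1, p))
    (h2 : ∀ k < b, C.useq (i + a + 1 + k + 1) ≠ ((C.useq i).1, p'))
    (harc : arcValue x p (C.useq (i + a + 1)).1 (C.vseq i) *
      arcValue x p' (C.useq i).1 (C.vseq (i + a + 1)) = C.dseq x i * C.dseq x (i + a + 1)) :
    False := by
  have e : C.useq (i + a + 1 + b + 1) = C.useq i := by
    rw [show i + a + 1 + b + 1 = i + C.len by omega, useq_add_len]
  have w1 := C.window_le x hC i a (by omega) p h1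
  have w2 := C.window_le x hC (i + a + 1) b (by omega) p' (by rw [e]; exact h2)
  rw [e] at w2
  have hD := fTilde_lt_prod_dseq hC i
  have hsplit : ∏ k ∈ range C.len, C.dseq x (i + k) = (C.dseq x i * C.dseq x (i + a + 1)) *
      ((∏ k ∈ range a, C.dseq x (i + k + 1)) * ∏ k ∈ range b, C.dseq x (i + a + 1 + k + 1)) := by
    rw [show C.len = (a + 1) + (b + 1) by omega, prod_range_add, prod_range_succ', prod_range_succ']
    have e1 : ∀ k, i + (k + 1) = i + k + 1 := fun k => by omega
    simp only [e1, Nat.add_zero, ← Nat.add_assoc]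
    ring
  rw [hsplit, ← harc] at hD
  have hmul := mul_le_mul w1 w2 (mul_nonneg (prod_nonneg fun k _ => C.dseq_nonneg x _)
    (arcValue_nonneg x _ _ _)) (Nat.cast_nonneg _)
  have hf : ((fTilde (a + 1) * fTilde (b + 1) : ℕ) : ℝ) ≤ fTilde (a + 1 + (b + 1)) := by
    exact_mod_cast fTilde_mul_le (Nat.succ_pos a) (Nat.succ_pos b)
  rw [show a + 1 + (b + 1) = C.len by omega] at hf
  push_cast at hf
  linarith

theorem useq_fst_inj (hC : MinimalViolating x C) {i j : ℕ} (hij : i < j) (hj : j < i + C.len) :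
    (C.useq i).1 ≠ (C.useq j).1 := by
  intro h
  obtain ⟨a, rfl⟩ : ∃ a, j = i + a + 1 := ⟨j - i - 1, by omega⟩
  refine false_of_swap hC i a (C.len - a - 2) (by omega) (C.useq i).2 (C.useq (i + a + 1)).2
    ?_ ?_ ?_
  · intro k hk hk'
    rw [← h] at hk'
    have := C.useq_inj (s := i) hk' (by omega) (by omega) (by omega) (by omega)
    omega
  · intro k hk hk'
    rw [h] at hk'
    have := C.useq_inj (s := i + a + 1) hk' (by omega) (by omega) (by omega) (by omega)
    omega
  · rw [dseq, dseq, h]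

theorem u_fst_injective (hC : MinimalViolating x C) :
    Function.Injective fun i => (C.u i).1 := by
  intro i j h
  by_contra hne
  dsimp only at h
  rw [← useq_val, ← useq_val] at h
  rcases lt_or_gt_of_ne hne with hlt | hlt
  · exact useq_fst_inj hC hlt (by omega) h
  · exact useq_fst_inj hC hlt (by omega) h.symm

theorem existsUnique_perpendicular
    (hstage : ∀ D : BipCycle (exchangeGraph M S), ¬ D.Violating (weight₀ x S) f)
    (hC : MinimalViolating x C) : ∃! i, (C.u i).2 = Part.perpendicular := by
  have hl := C.len_pos
  have hex : ∃ i, (C.u i).2 = Part.perpendicular := by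
    by_contra hno
    push Not at hno
    have hpar : ∀ k, (C.useq k).2 = Part.parallel := fun k => by
      have : (C.useq k).2 ≠ Part.perpendicular := hno _
      cases h : (C.useq k).2
      · rfl
      · exact absurd h this
    have hw := C.parallelWindow_le x hstage 0 (C.len - 1) (by omega)
      (fun k hk k' hk' h => by
        rcases lt_trichotomy k k' with hlt | heq | hlt
        · exact absurd h (useq_fst_inj hC (by omega) (by omega))
        · exact heq
        · exact absurd h.symm (useq_fst_inj hC (by omega) (by omega)))
      (fun k _ => hpar _)
    have hD := fTilde_lt_prod_dseq hC 0
    obtain ⟨l, hl'⟩ : ∃ l, C.len = l + 1 := ⟨C.len - 1, by omega⟩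
    have e : C.useq (0 + l + 1) = C.useq 0 := by
      rw [show 0 + l + 1 = 0 + C.len by omega, useq_add_len]
    have hf : (f C.len : ℝ) ≤ fTilde C.len := by exact_mod_cast f_le_fTilde hl
    have h0 : arcValue x Part.parallel (C.useq 0).1 (C.vseq 0) = C.dseq x 0 := by
      rw [dseq, hpar]
    rw [show C.len - 1 = l by omega, e, h0, ← hl'] at hw
    rw [show range C.len = range (l + 1) by rw [hl'], prod_range_succ'] at hD
    simp only [Nat.zero_add] at hw hD
    linarith
  obtain ⟨i, hi⟩ := hex
  refine ⟨i, hi, fun j hj => ?_⟩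
  by_contra hne
  have key : ∀ i j : Fin C.len, i < j → (C.u i).2 = Part.perpendicular →
      (C.u j).2 = Part.perpendicular → False := fun i j hij hi hj => by
    have hij' : (i : ℕ) < j := hij
    obtain ⟨a, ha⟩ : ∃ a, (j : ℕ) = i + a + 1 := ⟨j - i - 1, by omega⟩
    rw [← useq_val] at hi hj
    rw [ha] at hj
    have hjl := j.2
    refine false_of_swap hC i a (C.len - a - 2) (by omega) (C.useq (i + a + 1)).2 (C.useq i).2
      ?_ ?_ ?_
    · intro k hk hk'
      have := C.useq_inj (s := i) hk' (by omega) (by omega) (by omega) (by omega)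
      omega
    · intro k hk hk'
      have : C.useq (i + C.len) = C.useq i := C.useq_add_len i
      have := C.useq_inj (s := i + a + 1) (hk'.trans this.symm) (by omega) (by omega) (by omega)
        (by omega)
      omega
    · rw [dseq, dseq, hi, hj]
      simp only [arcValue]
      rw [perpRatio_mul_swap, mul_comm]
  rcases lt_or_gt_of_ne hne with hlt | hlt
  · exact key j i hlt hj hi
  · exact key i j hlt hi hj

end BipCycle

end DetMax

namespace DetMax

open Finset

namespace BipCycle

variable {n d : ℕ} {M : Matroid (Fin n)} {x : Fin n → EuclideanSpace ℝ (Fin d)}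
  {S : Finset (Fin n)} {C : BipCycle (augGraph M S)}

/-! ### Scaled entries of the matrix of a cycle -/

variable (x C) in
/-- Partial products of the arc values of a cycle, starting at the position `o`. -/
noncomputable def partialProd (o m : ℕ) : ℝ := ∏ k ∈ range m, C.dseq x (o + k)

variable (x C) in
/-- The arc values between vertices of the cycle, scaled so that the arcs of the cycle itself have
value `1`. -/
noncomputable def scaled (o : ℕ) (p : Part) (i j : ℕ) : ℝ :=
  C.partialProd x o i * arcValue x p (C.useq (o + i)).1 (C.vseq (o + j)) *
    (C.partialProd x o (j + 1))⁻¹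

theorem fTilde_lt_partialProd (hC : MinimalViolating x C) (o : ℕ) :
    (fTilde C.len : ℝ) < C.partialProd x o C.len :=
  fTilde_lt_prod_dseq hC o

theorem dseq_pos (hC : MinimalViolating x C) (k : ℕ) : 0 < C.dseq x k := by
  have h := fTilde_lt_prod_dseq hC k
  refine (C.dseq_nonneg x k).lt_of_ne' fun h0 => ?_
  rw [prod_eq_zero (mem_range.mpr C.len_pos) (by simpa using h0)] at h
  exact absurd h (not_lt.mpr (Nat.cast_nonneg _))

theorem partialProd_pos (hC : MinimalViolating x C) (o m : ℕ) : 0 < C.partialProd x o m :=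
  prod_pos fun _ _ => dseq_pos hC _

theorem partialProd_succ (o m : ℕ) :
    C.partialProd x o (m + 1) = C.partialProd x o m * C.dseq x (o + m) := prod_range_succ _ _

theorem partialProd_add (o a b : ℕ) : C.partialProd x o (a + b) =
    C.partialProd x o a * ∏ k ∈ range b, C.dseq x (o + (a + k)) := prod_range_add _ _ _

theorem partialProd_len_add (o a : ℕ) : C.partialProd x o (C.len + a) =
    C.partialProd x o C.len * C.partialProd x o a := by
  rw [partialProd_add]
  congr 1
  refine prod_congr rfl fun k _ => ?_
  rw [show o + (C.len + k) = o + k + C.len by omega, dseq_add_len]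

theorem scaled_nonneg (hC : MinimalViolating x C) (o : ℕ) (p : Part) (i j : ℕ) :
    0 ≤ C.scaled x o p i j :=
  mul_nonneg (mul_nonneg (partialProd_pos hC _ _).le (arcValue_nonneg x _ _ _))
    (inv_nonneg.mpr (partialProd_pos hC _ _).le)

theorem window_useq_ne (hC : MinimalViolating x C) (s m : ℕ) (hm : m < C.len) (p : Part) :
    ∀ k < m, C.useq (s + k + 1) ≠ ((C.useq (s + m + 1)).1, p) := fun k hk h =>
  useq_fst_inj hC (show s + k + 1 < s + m + 1 by omega) (by omega)
    (congrArg (fun q => q.1) h)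

theorem window_fst_inj (hC : MinimalViolating x C) (s m : ℕ) (hm : m < C.len) :
    ∀ k ≤ m, ∀ k' ≤ m, (C.useq (s + k + 1)).1 = (C.useq (s + k' + 1)).1 → k = k' := by
  intro k hk k' hk' h
  rcases lt_trichotomy k k' with hlt | heq | hlt
  · exact absurd h (useq_fst_inj hC (by omega) (by omega))
  · exact heq
  · exact absurd h.symm (useq_fst_inj hC (by omega) (by omega))

theorem scaled_le_of_window (hC : MinimalViolating x C) {o i j m : ℕ} {p : Part} {B : ℝ}
    (hi : i = j + 1 + m) (h : (∏ k ∈ range m, C.dseq x (o + j + k + 1)) *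
      arcValue x p (C.useq (o + j + m + 1)).1 (C.vseq (o + j)) ≤ B) :
    C.scaled x o p i j ≤ B := by
  subst hi
  refine le_trans (le_of_eq ?_) h
  have hne := (partialProd_pos hC o (j + 1)).ne'
  rw [scaled, partialProd_add, show o + (j + 1 + m) = o + j + m + 1 by omega]
  have e : ∀ k, o + (j + 1 + k) = o + j + k + 1 := fun k => by omega
  simp only [e]
  field_simp

theorem scaled_lower_le (hC : MinimalViolating x C) {o i j : ℕ} (p : Part) (hij : j < i)
    (hi : i < j + C.len) : C.scaled x o p i j ≤ fTilde (i - j) := by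
  obtain ⟨m, rfl⟩ : ∃ m, i = j + 1 + m := ⟨i - j - 1, by omega⟩
  rw [show j + 1 + m - j = m + 1 by omega]
  exact scaled_le_of_window hC rfl
    (C.window_le x hC (o + j) m (by omega) p (window_useq_ne hC _ _ (by omega) p))

theorem scaled_parallel_le (hstage : ∀ D : BipCycle (exchangeGraph M S),
      ¬ D.Violating (weight₀ x S) f) (hC : MinimalViolating x C) {o i j : ℕ} (hij : j < i)
    (hi : i ≤ j + C.len)
    (hpar : ∀ k, j < k → k < i → (C.useq (o + k)).2 = Part.parallel) :
    C.scaled x o Part.parallel i j ≤ f (i - j) := by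
  obtain ⟨m, rfl⟩ : ∃ m, i = j + 1 + m := ⟨i - j - 1, by omega⟩
  rw [show j + 1 + m - j = m + 1 by omega]
  refine scaled_le_of_window hC rfl
    (C.parallelWindow_le x hstage (o + j) m (by omega) (window_fst_inj hC _ _ (by omega)) ?_)
  intro k hk
  rw [show o + j + k + 1 = o + (j + k + 1) by omega]
  exact hpar _ (by omega) (by omega)

theorem scaled_len_add (o : ℕ) (p : Part) (i j : ℕ) :
    C.scaled x o p (C.len + i) j = C.partialProd x o C.len * C.scaled x o p i j := by
  rw [scaled, partialProd_len_add, show o + (C.len + i) = o + i + C.len by omega, useq_add_len,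
    scaled]
  ring

theorem scaled_le_div (hC : MinimalViolating x C) {o i j : ℕ} {p : Part} {B : ℝ}
    (hl : 2 ≤ C.len) (h : C.scaled x o p (C.len + i) j ≤ B) :
    C.scaled x o p i j ≤ B / (C.len.factorial : ℝ) ^ 11 := by
  rw [scaled_len_add] at h
  have hD := fTilde_lt_partialProd hC o
  rw [fTilde_of_ne_one (by omega)] at hD
  push_cast at hD
  rw [le_div_iff₀ (by positivity), mul_comm]
  exact (mul_le_mul_of_nonneg_right hD.le (scaled_nonneg hC _ _ _ _)).trans h

theorem scaled_upper_le (hC : MinimalViolating x C) (hl : 2 ≤ C.len) {o i j : ℕ} (p : Part)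
    (hij : i < j) (hj : j < C.len) : C.scaled x o p i j ≤
      2 * (((C.len + i - j).factorial : ℝ) / C.len.factorial) ^ 11 := by
  refine (scaled_le_div hC hl (scaled_lower_le hC p (by omega) (by omega))).trans ?_
  rw [div_pow, ← mul_div_assoc]
  gcongr
  exact_mod_cast fTilde_le _

theorem scaled_self (hC : MinimalViolating x C) (o i : ℕ) :
    C.scaled x o (C.useq (o + i)).2 i i = 1 := by
  rw [scaled, partialProd_succ, dseq]
  have h1 := (partialProd_pos hC o i).ne'
  have h2 := (dseq_pos hC (o + i)).ne'
  rw [dseq] at h2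
  field_simp

theorem scaled_perpendicular_eq (hC : MinimalViolating x C) {o : ℕ}
    (ho : (C.useq o).2 = Part.perpendicular) (i j : ℕ) :
    C.scaled x o Part.perpendicular i j =
      C.scaled x o Part.perpendicular i 0 * C.scaled x o Part.perpendicular 0 j := by
  have h := scaled_self hC o 0
  rw [Nat.add_zero, ho] at h
  rw [← mul_one (C.scaled x o Part.perpendicular i j), ← h]
  simp only [scaled, arcValue]
  have := perpRatio_mul_swap x (S := S) (C.useq (o + i)).1 (C.useq (o + 0)).1 (C.vseq (o + j))
    (C.vseq (o + 0))
  linear_combination (C.partialProd x o i * (C.partialProd x o (j + 1))⁻¹ * C.partialProd x o 0 *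
    (C.partialProd x o (0 + 1))⁻¹) * this

theorem scaled_perpendicular_le (hC : MinimalViolating x C) (hl : 2 ≤ C.len) {o : ℕ}
    (ho : (C.useq o).2 = Part.perpendicular) {i j : ℕ} (hi : i < C.len) (hj : j < C.len) :
    C.scaled x o Part.perpendicular i j ≤
      4 * ((i.factorial * (C.len - j).factorial : ℝ) / C.len.factorial) ^ 11 := by
  have h00 := scaled_self hC o 0
  rw [Nat.add_zero, ho] at h00
  have h1 : C.scaled x o Part.perpendicular i 0 ≤ 2 * (i.factorial : ℝ) ^ 11 := by
    rcases Nat.eq_zero_or_pos i with rfl | hi0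
    · rw [h00]; norm_num
    · refine (scaled_lower_le hC _ hi0 (by omega)).trans ?_
      exact_mod_cast fTilde_le _
  have h2 : C.scaled x o Part.perpendicular 0 j ≤
      2 * (((C.len - j).factorial : ℝ) / C.len.factorial) ^ 11 := by
    rcases Nat.eq_zero_or_pos j with rfl | hj0
    · rw [h00, Nat.sub_zero, div_self (by positivity)]; norm_num
    · exact scaled_upper_le hC hl _ hj0 hj
  rw [scaled_perpendicular_eq hC ho]
  refine (mul_le_mul h1 h2 (scaled_nonneg hC _ _ _ _) (by positivity)).trans (le_of_eq ?_)
  ring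

theorem permanent_cycleMatrix_le (hstage : ∀ D : BipCycle (exchangeGraph M S),
      ¬ D.Violating (weight₀ x S) f) (hC : MinimalViolating x C) (hl : 2 ≤ C.len) :
    (cycleMatrix x C).permanent ≤ 3 / 2 * ∏ i, arcValue x (C.u i).2 (C.u i).1 (C.v i) := by
  have hne : NeZero C.len := ⟨by omega⟩
  obtain ⟨o, ho, huniq⟩ := existsUnique_perpendicular hstage hC
  dsimp only at huniq
  rw [← useq_val] at ho
  have hpar : ∀ k : ℕ, 0 < k → k < C.len → (C.useq (o + k)).2 = Part.parallel := by
    intro k hk hkl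
    cases h : (C.useq (o + k)).2
    · rfl
    · have h1 := congrArg Fin.val (huniq _ h)
      have := eq_of_mod_eq (s := o) (h1.trans (Nat.mod_eq_of_lt o.2).symm) (by omega) (by omega)
        (by omega) (by omega)
      omega
  have hbound := permanent_scaled_le hl (fun i j => C.scaled x o Part.parallel i j)
    (fun i j => C.scaled x o Part.perpendicular i j) (fun i j => scaled_nonneg hC _ _ _ _)
    (fun i j => scaled_nonneg hC _ _ _ _)
    (fun i hi => by
      have := scaled_self hC o i
      rw [hpar i (by omega) i.2] at this
      exact this.le)
    (fun i hi => by
      rw [hi]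
      have h := scaled_le_div hC hl (scaled_parallel_le hstage hC (o := o) (i := C.len + 0) (j := 0)
        (by omega) (by omega) (fun k hk hk' => hpar k hk (by omega)))
      refine h.trans ?_
      rw [Nat.add_zero, Nat.sub_zero, div_le_div_iff₀ (by positivity) (by norm_num), one_mul]
      have h2 : 2 ≤ C.len.factorial := Nat.factorial_le hl
      have h3 : f C.len * 128 ≤ C.len.factorial ^ 11 := by
        calc f C.len * 128 = 2 ^ 8 * C.len.factorial ^ 3 := by unfold f; ring
          _ ≤ C.len.factorial ^ 8 * C.len.factorial ^ 3 := by gcongr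
          _ = _ := by ring
      exact_mod_cast h3)
    (fun i j hij => by
      have hij' : (j : ℕ) < i := hij
      refine (scaled_parallel_le hstage hC hij' (by omega)
        (fun k hk hk' => hpar k (by omega) (by omega))).trans (le_of_eq ?_)
      simp [f])
    (fun i j hij => scaled_upper_le hC hl _ hij j.2)
    (fun i hi => by
      rw [hi]
      have h := scaled_self hC o 0
      rw [Nat.add_zero, ho] at h
      exact h.le)
    (fun i j => scaled_perpendicular_le hC hl ho i.2 j.2)
  set e : Fin C.len ≃ Fin C.len := Equiv.addLeft o with he
  have hu : ∀ i : Fin C.len, C.useq (o + i) = C.u (e i) := fun i => rfl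
  have hv : ∀ i : Fin C.len, C.vseq (o + i) = C.v (e i) := fun i => rfl
  have hperm : (cycleMatrix x C).permanent = ((cycleMatrix x C).submatrix e e).permanent := by
    rw [← Matrix.permanent_permute_cols e, ← Matrix.permanent_permute_rows e]
    rfl
  have hscale := permanent_scale ((cycleMatrix x C).submatrix e e)
    (fun i => C.partialProd x o i) (fun j => (C.partialProd x o (j + 1))⁻¹)
  have heq : (Matrix.of fun i j : Fin C.len => C.partialProd x o i *
      (cycleMatrix x C).submatrix e e i j * (C.partialProd x o (j + 1))⁻¹) =
      Matrix.of fun i j : Fin C.len => C.scaled x o Part.parallel i j +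
        C.scaled x o Part.perpendicular i j := by
    ext i j
    simp only [Matrix.of_apply, Matrix.submatrix_apply, cycleMatrix, scaled, arcValue, hu, hv]
    ring
  rw [heq, ← hperm] at hscale
  rw [hscale, prod_inv_distrib, Fin.prod_univ_eq_prod_range (fun i => C.partialProd x o i),
    Fin.prod_univ_eq_prod_range (fun i => C.partialProd x o (i + 1))] at hbound
  have hE : ∏ i ∈ range C.len, C.partialProd x o (i + 1) =
      (∏ i ∈ range C.len, C.partialProd x o i) * C.partialProd x o C.len := by
    rw [← prod_range_succ, prod_range_succ']
    simp [partialProd]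
  have hD : C.partialProd x o C.len = ∏ i, arcValue x (C.u i).2 (C.u i).1 (C.v i) := by
    rw [partialProd, prod_dseq_shift, prod_dseq]
  have hpos := partialProd_pos hC o C.len
  have hpos' : 0 < ∏ i ∈ range C.len, C.partialProd x o i :=
    prod_pos fun i _ => partialProd_pos hC _ _
  rw [← hD]
  rw [hE] at hbound
  calc (cycleMatrix x C).permanent = ((∏ i ∈ range C.len, C.partialProd x o i) *
        (cycleMatrix x C).permanent * ((∏ i ∈ range C.len, C.partialProd x o i) *
        C.partialProd x o C.len)⁻¹) * C.partialProd x o C.len := by field_simp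
    _ ≤ _ := mul_le_mul_of_nonneg_right hbound hpos.le

end BipCycle

end DetMax

namespace DetMax

open Finset
open scoped Matrix

/-! ### Determinants -/

section Det

variable {ι : Type*} [Fintype ι] [DecidableEq ι]

theorem det_add_vecMulVec_row (A : Matrix ι ι ℝ) (w e : ι → ℝ) :
    (A + Matrix.vecMulVec w e).det = A.det + ∑ i, w i * (A.updateRow i e).det := by
  have key : ∀ s : Finset ι, (Matrix.of fun i j => A i j + if i ∈ s then w i * e j else 0).det =
      A.det + ∑ i ∈ s, w i * (A.updateRow i e).det := by
    intro s
    induction s using Finset.induction_on with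
    | empty => simp; rfl
    | insert a s ha ih =>
      set B : Matrix ι ι ℝ := Matrix.of fun i j => A i j + if i ∈ s then w i * e j else 0 with hB
      have h1 : (Matrix.of fun i j => A i j + if i ∈ insert a s then w i * e j else 0) =
          B.updateRow a (A a + w a • e) := by
        ext i j
        by_cases hi : i = a
        · subst hi; simp
        · simp [hi, hB, Matrix.updateRow_ne]
      have h2 : B.updateRow a (A a) = B := by
        ext i j
        by_cases hi : i = a
        · subst hi; simp [hB, ha]
        · simp [hi, Matrix.updateRow_ne]
      have h3 : (B.updateRow a e).det = (A.updateRow a e).det := by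
        refine Matrix.det_eq_of_forall_row_eq_smul_add_const
          (fun i => if i ∈ s then w i else 0) a (if_neg ha) fun i j => ?_
        by_cases hi : i = a
        · subst hi; simp [ha]
        · simp [hi, Matrix.updateRow_ne, hB]
      rw [h1, Matrix.det_updateRow_add, Matrix.det_updateRow_smul, h2, h3, ih, sum_insert ha]
      ring
  rw [← key univ]
  congr 1
  ext i j
  simp [Matrix.vecMulVec_apply]

theorem det_add_vecMulVec (A : Matrix ι ι ℝ) (w e : ι → ℝ) :
    (A + Matrix.vecMulVec w e).det = A.det + ∑ k, e k * (A.updateCol k w).det := by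
  rw [← Matrix.det_transpose, Matrix.transpose_add, Matrix.transpose_vecMulVec,
    det_add_vecMulVec_row, Matrix.det_transpose]
  congr 1
  refine sum_congr rfl fun k _ => ?_
  rw [Matrix.updateRow_transpose, Matrix.det_transpose]

/-- The determinant of the coefficient matrix after one coordinate direction has been replaced. -/
theorem det_add_vecMulVec_sub (A : Matrix ι ι ℝ) (c e : ι → ℝ) (o : ι) (h : ℝ) (he : e o * h = 1) :
    (A + Matrix.vecMulVec (fun i => c i - A i o * h) e).det =
      ∑ k, e k * (A.updateCol k c).det := by
  rw [det_add_vecMulVec]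
  have h1 : ∀ k, (A.updateCol k (fun i => c i - A i o * h)).det =
      (A.updateCol k c).det - h * if k = o then A.det else 0 := fun k => by
    have e1 : (fun i => c i - A i o * h) = c + (-h) • (fun i => A i o) := by
      ext i; simp; ring
    rw [e1, Matrix.det_updateCol_add, Matrix.det_updateCol_smul]
    split_ifs with hk
    · subst hk
      rw [Matrix.updateCol_eq_self]
      ring
    · have hz : (A.updateCol k fun i => A i o).det = 0 :=
        Matrix.det_zero_of_column_eq hk fun i => by
          rw [Matrix.updateCol_self, Matrix.updateCol_ne (Ne.symm hk)]
      rw [hz]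
      ring
  simp only [h1, mul_sub, sum_sub_distrib, mul_ite, mul_zero, sum_ite_eq', mem_univ, if_true]
  linear_combination -A.det * he

theorem det_eq_det_submatrix {κ : Type*} [Fintype κ] [DecidableEq κ] (B : Matrix ι ι ℝ) (v : κ → ι)
    (hv : Function.Injective v) (h : ∀ s, s ∉ Set.range v → ∀ t, B s t = if s = t then 1 else 0) :
    B.det = (B.submatrix v v).det := by
  classical
  rw [Matrix.twoBlockTriangular_det B (fun s => s ∈ Set.range v)
    (fun i hi j hj => by
      rw [h i hi, if_neg]
      rintro rfl
      exact hi hj)]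
  have h1 : (Matrix.toSquareBlockProp B fun i => ¬ i ∈ Set.range v) = 1 := by
    ext i j
    rw [Matrix.toSquareBlockProp_def, Matrix.of_apply, h i i.2, Matrix.one_apply]
    simp [Subtype.ext_iff]
  rw [h1, Matrix.det_one, mul_one]
  convert (Matrix.det_submatrix_equiv_self (Equiv.ofInjective v hv)
    (B.toSquareBlockProp fun s => s ∈ Set.range v)).symm
  rfl

theorem det_le_det_of_posSemidef_sub {A B : Matrix ι ι ℝ} (hA : A.PosSemidef)
    (hAB : (B - A).PosSemidef) : A.det ≤ B.det := by
  have hB : B.PosSemidef := by simpa using hA.add hAB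
  by_cases h0 : A.det = 0
  · rw [h0]; exact hB.det_nonneg
  obtain ⟨N, hN⟩ : ∃ N : Matrix ι ι ℝ, A = N.conjTranspose * N := by
    open scoped MatrixOrder Matrix.Norms.L2Operator in
    exact CStarAlgebra.nonneg_iff_eq_star_mul_self.mp hA.nonneg
  have hNd : N.det ≠ 0 := fun h => h0 (by rw [hN, Matrix.det_mul, h, mul_zero])
  have hNu : IsUnit N.det := hNd.isUnit
  set K := (N⁻¹).conjTranspose * (B - A) * N⁻¹ with hK
  have hKp : K.PosSemidef := hAB.conjTranspose_mul_mul_same _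
  have hBK : B = N.conjTranspose * (1 + K) * N := by
    have e1 : N.conjTranspose * (N⁻¹).conjTranspose = 1 := by
      rw [← Matrix.conjTranspose_mul, Matrix.nonsing_inv_mul _ hNu, Matrix.conjTranspose_one]
    have e2 : N⁻¹ * N = 1 := Matrix.nonsing_inv_mul _ hNu
    calc B = A + (B - A) := by abel
      _ = N.conjTranspose * N + (N.conjTranspose * (N⁻¹).conjTranspose) * (B - A) * (N⁻¹ * N) := by
        rw [e1, e2, ← hN, Matrix.one_mul, Matrix.mul_one]
      _ = _ := by
        rw [hK]; simp only [Matrix.mul_add, Matrix.add_mul, Matrix.mul_one, Matrix.mul_assoc]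
  have hH : (1 + K).IsHermitian := Matrix.isHermitian_one.add hKp.isHermitian
  have h1 : 1 ≤ (1 + K).det := by
    rw [hH.det_eq_prod_eigenvalues]
    calc (1 : ℝ) = ∏ _i : ι, 1 := by simp
      _ ≤ _ := prod_le_prod (fun _ _ => zero_le_one) fun i _ => ?_
    have hv : star (hH.eigenvectorBasis i).ofLp ⬝ᵥ (hH.eigenvectorBasis i).ofLp = 1 := by
      have h := hH.eigenvectorBasis.orthonormal.1 i
      rw [← sq_eq_sq₀ (norm_nonneg _) zero_le_one, EuclideanSpace.norm_sq_eq, one_pow] at h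
      rw [← h]
      simp [dotProduct, sq]
    have hnn := hKp.dotProduct_mulVec_nonneg (hH.eigenvectorBasis i).ofLp
    have := hH.eigenvalues_eq i
    rw [Matrix.add_mulVec, Matrix.one_mulVec, dotProduct_add, hv] at this
    simp only [RCLike.re_to_real] at this
    simp only [RCLike.ofReal_real_eq_id, id]
    linarith
  rw [hBK, Matrix.det_mul, Matrix.det_mul]
  have hA2 : A.det = N.conjTranspose.det * N.det := by rw [hN, Matrix.det_mul]
  have := hA.det_nonneg
  rw [hA2] at this ⊢
  nlinarith

end Det

section Gram

variable {ι E : Type*} [Fintype ι] [NormedAddCommGroup E] [InnerProductSpace ℝ E]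

theorem det_gram_map_le [DecidableEq ι] (z : ι → E) (Φ : E →L[ℝ] E) (hΦ : ‖Φ‖ ≤ 1) :
    (Matrix.gram ℝ (Φ ∘ z)).det ≤ (Matrix.gram ℝ z).det := by
  refine det_le_det_of_posSemidef_sub (Matrix.posSemidef_gram ℝ _) ?_
  have h1 := Matrix.posSemidef_opNorm_smul_gram_sub_gram z Φ
  have h2 : ((1 - ‖Φ‖ ^ 2) • Matrix.gram ℝ z).PosSemidef :=
    (Matrix.posSemidef_gram ℝ z).smul (by nlinarith [norm_nonneg Φ])
  have := h1.add h2
  have e : ‖Φ‖ ^ 2 • Matrix.gram ℝ z - Matrix.gram ℝ (Φ ∘ z) + (1 - ‖Φ‖ ^ 2) • Matrix.gram ℝ z =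
      Matrix.gram ℝ z - Matrix.gram ℝ (Φ ∘ z) := by
    rw [sub_smul, one_smul]
    abel
  rwa [e] at this

theorem gram_eq_mul (b z : ι → E) (Y : Matrix ι ι ℝ) (h : ∀ i, z i = ∑ k, Y i k • b k) :
    Matrix.gram ℝ z = Y * Matrix.gram ℝ b * Y.transpose := by
  ext i j
  rw [Matrix.gram_apply, h i, h j, sum_inner]
  simp only [inner_sum, inner_smul_left, inner_smul_right, Matrix.mul_apply, sum_mul,
    Matrix.transpose_apply, Matrix.gram_apply]
  rw [sum_comm]
  refine sum_congr rfl fun k _ => sum_congr rfl fun m _ => ?_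
  simp
  ring

theorem sq_det_mul_det_gram_le [DecidableEq ι] (b z : ι → E) (Φ : E →L[ℝ] E) (hΦ : ‖Φ‖ ≤ 1) (Y : Matrix ι ι ℝ)
    (h : ∀ i, Φ (z i) = ∑ k, Y i k • b k) :
    Y.det ^ 2 * (Matrix.gram ℝ b).det ≤ (Matrix.gram ℝ z).det := by
  refine le_trans (le_of_eq ?_) (det_gram_map_le z Φ hΦ)
  rw [gram_eq_mul b (Φ ∘ z) Y h, Matrix.det_mul, Matrix.det_mul, Matrix.det_transpose]
  ring

/-- Projection to `K` with the direction `η ∈ K` replaced by the direction `w ∈ Kᗮ`. -/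
noncomputable def replaceDirection (K : Submodule ℝ E) [K.HasOrthogonalProjection] (η w : E) :
    E →L[ℝ] E :=
  K.starProjection + (innerSL ℝ w - innerSL ℝ η).smulRight η

theorem replaceDirection_apply (K : Submodule ℝ E) [K.HasOrthogonalProjection] (η w z : E) :
    replaceDirection K η w z =
      K.starProjection z + (inner ℝ w z - inner ℝ η z) • η := rfl

theorem norm_replaceDirection_le (K : Submodule ℝ E) [K.HasOrthogonalProjection] {η w : E}
    (hη : η ∈ K) (hη1 : ‖η‖ = 1) (hw : w ∈ Kᗮ) (hw1 : ‖w‖ = 1) :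
    ‖replaceDirection K η w‖ ≤ 1 := by
  refine ContinuousLinearMap.opNorm_le_bound _ zero_le_one fun z => ?_
  rw [one_mul, replaceDirection_apply]
  refine _root_.le_of_sq_le_sq ?_ (norm_nonneg _)
  set y := K.starProjection z with hy
  have hyK : y ∈ K := Submodule.starProjection_apply_mem K z
  have hzy : z - y ∈ Kᗮ := Submodule.sub_starProjection_mem_orthogonal z
  have h1 : inner ℝ η z = inner ℝ y η := by
    have : inner ℝ η (z - y) = 0 := Submodule.inner_right_of_mem_orthogonal hη hzy
    rw [inner_sub_right, real_inner_comm y η] at this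
    linarith
  have h2 : inner ℝ w z = inner ℝ w (z - y) := by
    have : inner ℝ w y = 0 := Submodule.inner_left_of_mem_orthogonal hyK hw
    rw [inner_sub_right, this, sub_zero]
  have h3 : ‖z‖ ^ 2 = ‖y‖ ^ 2 + ‖z - y‖ ^ 2 := by
    have h4 : inner ℝ y (z - y) = 0 := Submodule.inner_right_of_mem_orthogonal hyK hzy
    have := norm_add_sq_real y (z - y)
    rw [h4] at this
    simpa using this
  have h5 : |inner ℝ w (z - y)| ≤ ‖z - y‖ := by
    have := abs_real_inner_le_norm w (z - y)
    rwa [hw1, one_mul] at this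
  have h6 : inner ℝ w (z - y) ^ 2 ≤ ‖z - y‖ ^ 2 := sq_le_sq' (abs_le.mp h5).1 (abs_le.mp h5).2
  rw [norm_add_sq_real, norm_smul, hη1, inner_smul_right, mul_one, Real.norm_eq_abs, sq_abs, h1, h2,
    h3]
  nlinarith [sq_nonneg (inner ℝ y η)]

end Gram

end DetMax

namespace DetMax

open Finset

/-! ### Volumes after an exchange -/

section Volume

variable {n d : ℕ} {x : Fin n → EuclideanSpace ℝ (Fin d)} {S : Finset (Fin n)}

theorem linearIndependent_of_vol_pos (h : 0 < vol x S) :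
    LinearIndependent ℝ (fun i : {i // i ∈ S} => x i) := by
  apply Matrix.linearIndependent_of_det_gram_ne_zero
  intro h0
  rw [vol, h0, Real.sqrt_zero] at h
  exact lt_irrefl _ h

theorem mem_spanOf {v : Fin n} (hv : v ∈ S) : x v ∈ spanOf x S :=
  Submodule.subset_span ⟨⟨v, hv⟩, rfl⟩

theorem perp_mem_orthogonal (u : Fin n) : perp x S u ∈ (spanOf x S)ᗮ :=
  Submodule.sub_starProjection_mem_orthogonal _

theorem par_eq_sum (hli : LinearIndependent ℝ (fun i : {i // i ∈ S} => x i)) (u : Fin n) :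
    par x S u = ∑ s : {i // i ∈ S}, coeff x S u s • x s := by
  have h := hli.linearCombination_repr ⟨par x S u, par_mem x S u⟩
  rw [Finsupp.linearCombination_apply, Finsupp.sum_fintype _ _ (by simp)] at h
  simp only [coeff, dif_pos hli]
  exact h.symm

theorem inner_perp_erase_of_ne {s t : Fin n} (ht : t ∈ S) (hts : t ≠ s) :
    inner ℝ (x t) (perp x (S.erase s) s) = 0 :=
  Submodule.inner_right_of_mem_orthogonal (mem_spanOf (mem_erase.mpr ⟨hts, ht⟩))
    (perp_mem_orthogonal s)

theorem inner_perp_self (u : Fin n) : inner ℝ (x u) (perp x S u) = ‖perp x S u‖ ^ 2 := by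
  have h : inner ℝ (par x S u) (perp x S u) = 0 :=
    Submodule.inner_right_of_mem_orthogonal (par_mem x S u) (perp_mem_orthogonal u)
  have e : x u = perp x S u + par x S u := by simp [perp]
  nth_rewrite 1 [e]
  rw [inner_add_left, h, add_zero, real_inner_self_eq_norm_sq]

theorem perp_erase_mem {s : Fin n} (hs : s ∈ S) : perp x (S.erase s) s ∈ spanOf x S := by
  refine Submodule.sub_mem _ (mem_spanOf hs) ?_
  refine (Submodule.span_mono ?_ : spanOf x (S.erase s) ≤ spanOf x S) (par_mem x (S.erase s) s)
  rintro _ ⟨i, rfl⟩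
  exact ⟨⟨i, mem_of_mem_erase i.2⟩, rfl⟩

theorem perp_erase_ne_zero (hli : LinearIndependent ℝ (fun i : {i // i ∈ S} => x i)) {s : Fin n}
    (hs : s ∈ S) : perp x (S.erase s) s ≠ 0 := by
  intro h
  have h1 := linearIndependent_iff_notMem_span.mp hli ⟨s, hs⟩
  apply h1
  have h2 : x s = par x (S.erase s) s := sub_eq_zero.mp h
  have h3 : par x (S.erase s) s ∈ spanOf x (S.erase s) := par_mem x (S.erase s) s
  rw [← h2] at h3
  refine Submodule.span_mono ?_ h3
  rintro _ ⟨i, rfl⟩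
  refine ⟨⟨i, mem_of_mem_erase i.2⟩, ?_, rfl⟩
  simpa [Subtype.ext_iff] using ne_of_mem_erase i.2

theorem abs_inner_le_of_unit {E : Type*} [NormedAddCommGroup E] [InnerProductSpace ℝ E] {w : E}
    (hw : ‖w‖ = 1) (z : E) : |inner ℝ w z| ≤ ‖z‖ := by
  have := abs_real_inner_le_norm w z
  rwa [hw, one_mul] at this

theorem sq_det_mul_sq_vol_le {T : Finset (Fin n)} (g : {i // i ∈ S} ≃ {i // i ∈ T})
    (Φ : EuclideanSpace ℝ (Fin d) →L[ℝ] EuclideanSpace ℝ (Fin d)) (hΦ : ‖Φ‖ ≤ 1)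
    (Y : Matrix {i // i ∈ S} {i // i ∈ S} ℝ) (h : ∀ i, Φ (x (g i)) = ∑ k, Y i k • x k) :
    |Y.det| * vol x S ≤ vol x T := by
  have h1 := sq_det_mul_det_gram_le (fun i : {i // i ∈ S} => x i) (fun i => x (g i)) Φ hΦ Y h
  have h2 : (Matrix.gram ℝ fun i : {i // i ∈ S} => x (g i)).det =
      (Matrix.gram ℝ fun i : {i // i ∈ T} => x i).det :=
    Matrix.det_submatrix_equiv_self g (Matrix.gram ℝ fun i : {i // i ∈ T} => x i)
  rw [h2] at h1
  unfold vol
  rw [← Real.sqrt_sq_eq_abs, ← Real.sqrt_mul (sq_nonneg _)]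
  exact Real.sqrt_le_sqrt h1

theorem exists_exchange_equiv {l : ℕ} (u : Fin l → {u // u ∉ S}) (v : Fin l → {v // v ∈ S})
    (hu : Function.Injective u) (hv : Function.Injective v) :
    ∃ g : {i // i ∈ S} ≃ {i // i ∈ symmDiff S
        (univ.image (fun i => (u i).1) ∪ univ.image (fun i => (v i).1))},
      (∀ i, (g (v i)).1 = u i) ∧ ∀ s, s ∉ Set.range v → (g s).1 = s := by
  set T := symmDiff S (univ.image (fun i => (u i).1) ∪ univ.image (fun i => (v i).1)) with hT
  set g₀ : {i // i ∈ S} → Fin n := Function.extend v (fun i => (u i).1) fun s => s.1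
  have hg1 : ∀ i, g₀ (v i) = u i := fun i => hv.extend_apply _ _ i
  have hg2 : ∀ s, s ∉ Set.range v → g₀ s = s := fun s hs => Function.extend_apply' _ _ s hs
  have hmem : ∀ s, g₀ s ∈ T := fun s => by
    rw [hT, mem_symmDiff]
    by_cases hs : s ∈ Set.range v
    · obtain ⟨i, rfl⟩ := hs
      rw [hg1]
      exact Or.inr ⟨mem_union_left _ (mem_image_of_mem _ (mem_univ i)), (u i).2⟩
    · rw [hg2 s hs]
      refine Or.inl ⟨s.2, fun h => ?_⟩
      rcases mem_union.mp h with h | h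
      · obtain ⟨i, -, hi⟩ := mem_image.mp h
        exact (u i).2 (hi ▸ s.2)
      · obtain ⟨i, -, hi⟩ := mem_image.mp h
        exact hs ⟨i, Subtype.ext hi⟩
  have hbij : Function.Bijective fun s => (⟨g₀ s, hmem s⟩ : {i // i ∈ T}) := by
    constructor
    · intro s t hst
      have hst' : g₀ s = g₀ t := congrArg Subtype.val hst
      by_cases hs : s ∈ Set.range v <;> by_cases ht : t ∈ Set.range v
      · obtain ⟨i, rfl⟩ := hs
        obtain ⟨j, rfl⟩ := ht
        rw [hg1, hg1] at hst'
        rw [hu (Subtype.ext hst')]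
      · obtain ⟨i, rfl⟩ := hs
        rw [hg1, hg2 t ht] at hst'
        exact absurd (hst' ▸ t.2) (u i).2
      · obtain ⟨j, rfl⟩ := ht
        rw [hg1, hg2 s hs] at hst'
        exact absurd (hst' ▸ s.2) (u j).2
      · rw [hg2 s hs, hg2 t ht] at hst'
        exact Subtype.ext hst'
    · rintro ⟨t, ht⟩
      rw [hT, mem_symmDiff] at ht
      rcases ht with ⟨htS, ht⟩ | ⟨ht, htS⟩
      · refine ⟨⟨t, htS⟩, Subtype.ext (hg2 _ ?_)⟩
        rintro ⟨i, hi⟩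
        exact ht (mem_union_right _ (mem_image.mpr ⟨i, mem_univ i, congrArg Subtype.val hi⟩))
      · rcases mem_union.mp ht with h | h
        · obtain ⟨i, -, rfl⟩ := mem_image.mp h
          exact ⟨v i, Subtype.ext (hg1 i)⟩
        · obtain ⟨i, -, rfl⟩ := mem_image.mp h
          exact absurd (v i).2 htS
  exact ⟨Equiv.ofBijective _ hbij, hg1, hg2⟩

/-- A lower bound for the volume after an exchange in terms of coefficients, where one direction of
the span of `S` is replaced by the direction of a perpendicular component. -/
theorem exists_det_mul_vol_le (hli : LinearIndependent ℝ (fun i : {i // i ∈ S} => x i)) {l : ℕ}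
    (u : Fin l → {u // u ∉ S}) (v : Fin l → {v // v ∈ S}) (hu : Function.Injective u)
    (hv : Function.Injective v) (o : Fin l) (ho : perp x S (u o) ≠ 0) :
    ∃ c e : Fin l → ℝ, (∀ i, |c i| ≤ ‖perp x S (u i)‖) ∧ c o = ‖perp x S (u o)‖ ∧
      (∀ k, |e k| ≤ ‖perp x (S.erase (v k)) (v k)‖⁻¹) ∧
      e o = ‖perp x (S.erase (v o)) (v o)‖⁻¹ ∧
      |∑ k, e k * ((Matrix.of fun i j => coeff x S (u i) (v j)).updateCol k c).det| * vol x S ≤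
        vol x (symmDiff S (univ.image (fun i => (u i).1) ∪ univ.image (fun i => (v i).1))) := by
  obtain ⟨g, hg1, hg2⟩ := exists_exchange_equiv u v hu hv
  set K := spanOf x S with hK
  set q := perp x (S.erase (v o)) (v o) with hq
  set η : EuclideanSpace ℝ (Fin d) := ‖q‖⁻¹ • q with hη
  set w : EuclideanSpace ℝ (Fin d) := ‖perp x S (u o)‖⁻¹ • perp x S (u o) with hw
  have hq0 : q ≠ 0 := perp_erase_ne_zero hli (v o).2
  have hqn : ‖q‖ ≠ 0 := norm_ne_zero_iff.mpr hq0
  have hηK : η ∈ K := Submodule.smul_mem _ _ (perp_erase_mem (v o).2)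
  have hη1 : ‖η‖ = 1 := by rw [hη, norm_smul, norm_inv, norm_norm, inv_mul_cancel₀ hqn]
  have hwK : w ∈ Kᗮ := Submodule.smul_mem _ _ (perp_mem_orthogonal _)
  have hw1 : ‖w‖ = 1 := by
    rw [hw, norm_smul, norm_inv, norm_norm, inv_mul_cancel₀ (norm_ne_zero_iff.mpr ho)]
  set r : {i // i ∈ S} → ℝ := fun s => hli.repr ⟨η, hηK⟩ s with hr
  have hηr : η = ∑ s : {i // i ∈ S}, r s • x s := by
    have h := hli.linearCombination_repr ⟨η, hηK⟩
    rw [Finsupp.linearCombination_apply, Finsupp.sum_fintype _ _ (by simp)] at h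
    exact h.symm
  have hηb : ∀ s : {i // i ∈ S}, inner ℝ η (x s) = if s = v o then ‖q‖ else 0 := fun s => by
    rw [hη, inner_smul_left, real_inner_comm]
    split_ifs with h
    · rw [h, inner_perp_self, ← hq]
      simp only [conj_trivial]
      field_simp
    · rw [inner_perp_erase_of_ne s.2 (fun h' => h (Subtype.ext h')), mul_zero]
  have hrq : ∀ s : {i // i ∈ S}, r s = inner ℝ η (perp x (S.erase s) s) *
      (‖perp x (S.erase s) s‖ ^ 2)⁻¹ := fun s => by
    have h0 : ‖perp x (S.erase s) s‖ ≠ 0 := norm_ne_zero_iff.mpr (perp_erase_ne_zero hli s.2)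
    rw [eq_mul_inv_iff_mul_eq₀ (pow_ne_zero _ h0), hηr, sum_inner, sum_eq_single s]
    · rw [inner_smul_left, inner_perp_self]; rfl
    · intro t _ hts
      rw [inner_smul_left, inner_perp_erase_of_ne t.2 (fun h => hts (Subtype.ext h)), mul_zero]
    · simp
  have hwpar : ∀ z ∈ K, inner ℝ w z = 0 := fun z hz =>
    Submodule.inner_left_of_mem_orthogonal hz hwK
  have hwperp : ∀ i, inner ℝ w (x (u i)) = inner ℝ w (perp x S (u i)) := fun i => by
    have e : x (u i) = perp x S (u i) + par x S (u i) := by simp [perp]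
    nth_rewrite 1 [e]
    rw [inner_add_right, hwpar _ (par_mem x S (u i)), add_zero]
  have hηperp : ∀ i, inner ℝ η (x (u i)) = coeff x S (u i) (v o) * ‖q‖ := fun i => by
    have e : x (u i) = perp x S (u i) + par x S (u i) := by simp [perp]
    have h0 : inner ℝ η (perp x S (u i)) = 0 :=
      Submodule.inner_right_of_mem_orthogonal hηK (perp_mem_orthogonal _)
    rw [e, inner_add_right, h0, zero_add, par_eq_sum hli, inner_sum]
    simp only [inner_smul_right, hηb]
    simp
  set c : Fin l → ℝ := fun i => inner ℝ w (x (u i)) with hc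
  set e : Fin l → ℝ := fun k => r (v k) with he
  have heo : e o = ‖q‖⁻¹ := by
    have h1 : inner ℝ η q = ‖q‖ := by
      rw [hη, inner_smul_left, real_inner_self_eq_norm_sq]
      simp only [conj_trivial]
      field_simp
    simp only [he]
    rw [hrq, ← hq, h1]
    field_simp
  refine ⟨c, e, fun i => ?_, ?_, fun k => ?_, heo, ?_⟩
  · simp only [hc]
    rw [hwperp]
    exact abs_inner_le_of_unit hw1 _
  · simp only [hc]
    rw [hwperp, hw, inner_smul_left, real_inner_self_eq_norm_sq]
    have := norm_ne_zero_iff.mpr ho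
    simp only [conj_trivial]
    field_simp
  · have h0 : 0 < ‖perp x (S.erase (v k)) (v k)‖ :=
      norm_pos_iff.mpr (perp_erase_ne_zero hli (v k).2)
    simp only [he]
    rw [hrq, abs_mul, abs_inv, abs_of_pos (pow_pos h0 2)]
    calc _ ≤ ‖perp x (S.erase (v k)) (v k)‖ * (‖perp x (S.erase (v k)) (v k)‖ ^ 2)⁻¹ := by
          gcongr
          exact abs_inner_le_of_unit hη1 _
      _ = _ := by field_simp
  · set R₁ : Fin l → {i // i ∈ S} → ℝ := fun i t =>
      coeff x S (u i) t + (c i - coeff x S (u i) (v o) * ‖q‖) * r t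
    set R₂ : {i // i ∈ S} → {i // i ∈ S} → ℝ := fun s t => if s = t then 1 else 0
    set Y : Matrix {i // i ∈ S} {i // i ∈ S} ℝ := Matrix.of (Function.extend v R₁ R₂)
    have hY1 : ∀ i t, Y (v i) t =
        coeff x S (u i) t + (c i - coeff x S (u i) (v o) * ‖q‖) * r t := fun i =>
      congrFun (hv.extend_apply R₁ R₂ i)
    have hY2 : ∀ s, s ∉ Set.range v → ∀ t, Y s t = if s = t then 1 else 0 := fun s hs =>
      congrFun (Function.extend_apply' R₁ R₂ s hs)
    have hΦ : ∀ s, replaceDirection K η w (x (g s)) = ∑ k, Y s k • x k := fun s => by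
      rw [replaceDirection_apply]
      by_cases hs : s ∈ Set.range v
      · obtain ⟨i, rfl⟩ := hs
        rw [hg1, hηperp]
        have hp : K.starProjection (x (u i)) = ∑ s : {i // i ∈ S}, coeff x S (u i) s • x s :=
          par_eq_sum hli (u i)
        rw [hp]
        conv_lhs => rw [hηr]
        simp only [hY1, add_smul, sum_add_distrib, smul_sum, mul_smul]
        rfl
      · have hso : ¬ s = v o := fun h => hs ⟨o, h.symm⟩
        rw [hg2 s hs, hwpar _ (mem_spanOf s.2), hηb, if_neg hso]
        have hp : K.starProjection (x s) = x s :=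
          Submodule.starProjection_eq_self_iff.mpr (mem_spanOf s.2)
        rw [hp, sub_zero, zero_smul, add_zero]
        simp [hY2 s hs]
    have hmain := sq_det_mul_sq_vol_le g (replaceDirection K η w)
      (norm_replaceDirection_le K hηK hη1 hwK hw1) Y hΦ
    have hdet : Y.det = ∑ k, e k *
        ((Matrix.of fun i j => coeff x S (u i) (v j)).updateCol k c).det := by
      rw [det_eq_det_submatrix Y v hv hY2, ← det_add_vecMulVec_sub _ c e o ‖q‖
        (by rw [heo, inv_mul_cancel₀ hqn])]
      congr 1
      ext i j
      simp [hY1, Matrix.vecMulVec_apply, he]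
    rwa [hdet] at hmain

end Volume

end DetMax

namespace DetMax

open Finset

theorem two_mul_abs_sub_sum_abs_le {ι : Type*} [Fintype ι] (t : ι → ℝ) (a : ι) :
    2 * |t a| - ∑ i, |t i| ≤ |∑ i, t i| := by
  classical
  rw [← add_sum_erase univ t (mem_univ a), ← add_sum_erase univ (fun i => |t i|) (mem_univ a)]
  have h1 := abs_sum_le_sum_abs t (univ.erase a)
  have h2 := abs_sub_abs_le_abs_add (t a) (∑ i ∈ univ.erase a, t i)
  linarith

theorem two_mul_sub_permanent_le {ι : Type*} [Fintype ι] [DecidableEq ι] (A : Matrix ι ι ℝ)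
    (c e : ι → ℝ) (p : ι → ι → ℝ) (hp : ∀ i k, |c i * e k| ≤ p i k) (o : ι) :
    2 * |c o * e o * ∏ i ∈ univ.erase o, A i i| -
        (Matrix.of fun i j => |A i j| + p i j).permanent ≤
      |∑ k, e k * (A.updateCol k c).det| := by
  set t : ι × Equiv.Perm ι → ℝ := fun q =>
    Equiv.Perm.sign q.2 * (c (q.2 q.1) * e q.1 * ∏ i ∈ univ.erase q.1, A (q.2 i) i) with ht
  have hsum : ∑ k, e k * (A.updateCol k c).det = ∑ q, t q := by
    rw [Fintype.sum_prod_type]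
    refine sum_congr rfl fun k _ => ?_
    rw [Matrix.det_apply', mul_sum]
    refine sum_congr rfl fun σ _ => ?_
    rw [← mul_prod_erase univ _ (mem_univ k), Matrix.updateCol_self]
    have h : ∏ i ∈ univ.erase k, A.updateCol k c (σ i) i = ∏ i ∈ univ.erase k, A (σ i) i :=
      prod_congr rfl fun i hi => by rw [Matrix.updateCol_ne (ne_of_mem_erase hi)]
    rw [h]
    simp only [ht]
    ring
  have habs : ∀ q, |t q| = |c (q.2 q.1) * e q.1| * ∏ i ∈ univ.erase q.1, |A (q.2 i) i| := by
    intro q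
    simp only [ht]
    rw [abs_mul, abs_mul, abs_prod]
    have : |((Equiv.Perm.sign q.2 : ℤ) : ℝ)| = 1 := by
      rcases Int.units_eq_one_or (Equiv.Perm.sign q.2) with h | h <;> simp [h]
    rw [this, one_mul]
  have hle : ∑ q, |t q| ≤ (Matrix.of fun i j => |A i j| + p i j).permanent := by
    rw [Fintype.sum_prod_type, sum_comm]
    refine sum_le_sum fun σ _ => ?_
    have h := prod_add_sum_mul_prod_erase_le univ (fun i => |A (σ i) i|) (fun i => p (σ i) i)
      (fun i => abs_nonneg _) (fun i => (abs_nonneg _).trans (hp _ _))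
    have h0 : 0 ≤ ∏ i, |A (σ i) i| := prod_nonneg fun i _ => abs_nonneg _
    calc _ = ∑ k, |c (σ k) * e k| * ∏ i ∈ univ.erase k, |A (σ i) i| :=
          sum_congr rfl fun k _ => habs (k, σ)
      _ ≤ ∑ k, p (σ k) k * ∏ i ∈ univ.erase k, |A (σ i) i| :=
          sum_le_sum fun k _ => mul_le_mul_of_nonneg_right (hp _ _)
            (prod_nonneg fun i _ => abs_nonneg _)
      _ ≤ _ := by
        simp only [Matrix.of_apply]
        linarith
  have hmain : t (o, 1) = c o * e o * ∏ i ∈ univ.erase o, A i i := by simp [ht]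
  have := two_mul_abs_sub_sum_abs_le t (o, 1)
  rw [hsum, ← hmain]
  linarith

theorem two_mul_vol_le {n d : ℕ} {M : Matroid (Fin n)} {x : Fin n → EuclideanSpace ℝ (Fin d)}
    {S : Finset (Fin n)} {C : BipCycle (augGraph M S)} (hvol : 0 < vol x S)
    (hstage : ∀ D : BipCycle (exchangeGraph M S), ¬ D.Violating (weight₀ x S) f)
    (hC : MinimalViolating x C) : 2 * vol x S ≤ vol x (symmDiff S (support C)) := by
  obtain ⟨o, ho, huniq⟩ := BipCycle.existsUnique_perpendicular hstage hC
  dsimp only at ho huniq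
  have hviol := (violating_iff x C fTilde).mp hC.1
  set D := ∏ i, arcValue x (C.u i).2 (C.u i).1 (C.v i) with hD
  have hsplit : D = perpRatio x S (C.u o).1 (C.v o) *
      ∏ i ∈ univ.erase o, |coeff x S (C.u i).1 (C.v i)| := by
    rw [hD, ← mul_prod_erase univ _ (mem_univ o), ho]
    congr 1
    refine prod_congr rfl fun i hi => ?_
    have h : (C.u i).2 = Part.parallel := by
      cases h : (C.u i).2
      · rfl
      · exact absurd (huniq i h) (ne_of_mem_erase hi)
    rw [h]
    rfl
  have hDpos : 0 < D := lt_of_le_of_lt (Nat.cast_nonneg _) hviol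
  have hperp : perp x S (C.u o).1 ≠ 0 := fun h => by
    rw [hsplit, perpRatio, h, norm_zero, zero_div, zero_mul] at hDpos
    exact lt_irrefl _ hDpos
  obtain ⟨c, e, hc, hco, he, heo, hmain⟩ := exists_det_mul_vol_le (linearIndependent_of_vol_pos hvol)
    (fun i => (C.u i).1) C.v (BipCycle.u_fst_injective hC) C.v_inj o hperp
  refine le_trans (mul_le_mul_of_nonneg_right ?_ hvol.le) hmain
  set A : Matrix (Fin C.len) (Fin C.len) ℝ :=
    Matrix.of fun i j => coeff x S (C.u i).1 (C.v j) with hA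
  have hco' : c o * e o = perpRatio x S (C.u o).1 (C.v o) := by
    rw [hco, heo, perpRatio, div_eq_mul_inv]
  have hprod : |c o * e o * ∏ i ∈ univ.erase o, A i i| = D := by
    rw [abs_mul, abs_prod, hco', abs_of_nonneg (perpRatio_nonneg x _ _), hsplit]
    rfl
  by_cases hl : 2 ≤ C.len
  · have h1 := two_mul_sub_permanent_le A c e
      (fun i j => perpRatio x S (C.u i).1 (C.v j)) (fun i k => by
        rw [abs_mul, perpRatio, div_eq_mul_inv]
        exact mul_le_mul (hc i) (he k) (abs_nonneg _) (norm_nonneg _)) o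
    have h2 : (cycleMatrix x C).permanent ≤ 3 / 2 * D :=
      BipCycle.permanent_cycleMatrix_le hstage hC hl
    have h3 : (4 : ℝ) ≤ fTilde C.len := by
      rw [fTilde_of_ne_one (by omega)]
      have : 2 ≤ C.len.factorial := Nat.factorial_le hl
      exact_mod_cast (show 4 ≤ 2 ^ 11 by norm_num).trans (Nat.pow_le_pow_left this 11)
    rw [hprod] at h1
    change 2 * D - (cycleMatrix x C).permanent ≤ _ at h1
    linarith
  · have hl1 : C.len = 1 := by have := C.len_pos; omega
    have hsub : Subsingleton (Fin C.len) := by rw [hl1]; infer_instance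
    rw [Fintype.sum_subsingleton _ o, Matrix.det_eq_elem_of_subsingleton _ o,
      Matrix.updateCol_self, mul_comm]
    have hemp : univ.erase o = ∅ := by
      ext i
      simp [Subsingleton.elim i o]
    rw [hemp, prod_empty, mul_one] at hprod
    rw [hprod]
    rw [hl1] at hviol
    have : (fTilde 1 : ℝ) = 2 := by simp [fTilde]
    linarith

end DetMax

theorem mainTheorem8 {n d : ℕ} (M : Matroid (Fin n)) (x : Fin n → EuclideanSpace ℝ (Fin d))
    (S : Finset (Fin n)) (hS : M.IsBase (S : Set (Fin n))) (hvol : 0 < DetMax.vol x S)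
    (hstage : ∀ D : DetMax.BipCycle (DetMax.exchangeGraph M S),
      ¬ D.Violating (DetMax.weight₀ x S) DetMax.f)
    (C : DetMax.BipCycle (DetMax.augGraph M S)) (hC : DetMax.MinimalViolating x C) :
    (∃! i, (C.u i).2 = DetMax.Part.perpendicular) ∧
    (2 ≤ C.len → ENNReal.ofReal (DetMax.cycleMatrix x C).permanent ≤
      ENNReal.ofReal 1.56 * EReal.exp (-C.weight (DetMax.augWeight₀ x S))) ∧
    2 * DetMax.vol x S ≤ DetMax.vol x (symmDiff S (DetMax.support C)) := by
  refine ⟨DetMax.BipCycle.existsUnique_perpendicular hstage hC, fun hl => ?_,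
    DetMax.two_mul_vol_le hvol hstage hC⟩
  rw [DetMax.weight_eq, DetMax.exp_neg_negLog, ← ENNReal.ofReal_mul (by norm_num)]
  apply ENNReal.ofReal_le_ofReal
  refine (DetMax.BipCycle.permanent_cycleMatrix_le hstage hC hl).trans ?_
  exact mul_le_mul_of_nonneg_right (by norm_num)
    (Finset.prod_nonneg fun i _ => DetMax.arcValue_nonneg x _ _ _)
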